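/- Conventions. Groups are discrete. A group $\Gamma$ is just-infinite if it is infinite and every non-trivial normal subgroup of $\Gamma$ has finite index; icc if every conjugacy class other than $\{1\}$ is infinite; amenable if $\ell^\infty(\Gamma)$ admits a left-invariant mean. Let $\lambda_\Gamma$ be the left regular representation on $\ell^2(\Gamma)$; for a unitary representation $\pi$ of $\Gamma$ on a non-zero Hilbert space $H_\pi$, let $C^*_\pi(\Gamma)\subset B(H_\pi)$ be the $C^*$-algebra generated by $\pi(\Gamma)$. $\Gamma$ is $C^*$-simple if $C^*_{\lambda_\Gamma}(\Gamma)$ has no closed two-sided ideals other than $0$ and itself. $\Gamma$ acts on $B(H_\pi)$ by $x\mapsto \pi(g)x\pi(g)^*$. We write $\pi\prec\lambda_\Gamma$ if $\lambda_\Gamma(g)\mapsto\pi(g)$ extends to a $*$-representation of $C^*_{\lambda_\Gamma}(\Gamma)$, again denoted $\pi$. An invariant unital $C^*$-subalgebra $A\subset C^*_\pi(\Gamma)$ is co-finite in $C^*_\pi(\Gamma)$ if its commutant $A'\subset B(H_\pi)$ admits a normal $\Gamma$-invariant state. Finally, $\Gamma$ is nc-just-infinite if it is infinite and, for every $\Gamma$-invariant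 unital $C^*$-subalgebra $A\neq\mathbb{C}1$ of $C^*_{\lambda_\Gamma}(\Gamma)$ and every $\pi\prec\lambda_\Gamma$, $\pi(A)$ is co-finite in $C^*_\pi(\Gamma)$. Proposition. Let $\Gamma$ be an nc-just-infinite group. Then (i) $\Gamma$ is amenable or $C^*$-simple; (ii) $\Gamma$ is icc. Moreover: (a) there is a simple non-amenable group that is just-infinite but not nc-just-infinite; (b) the group $\mathbb{Z}$ is just-infinite but not nc-just-infinite. -/

import Mathlib

noncomputable section

namespace NCJI

open scoped ENNReal ComplexOrder InnerProductSpace lp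

universe u v

section Representations

variable {Γ : Type u} [Group Γ]
variable {H : Type v} [NormedAddCommGroup H] [InnerProductSpace ℂ H] [CompleteSpace H]

/-- `C*_π(Γ)`: the C*-algebra generated by the unitaries `π(g)`, `g ∈ Γ`, in `B(H)`, for a unitary
representation `π` of the discrete group `Γ` on the Hilbert space `H`. -/
def groupCStar (π : Γ →* unitary (H →L[ℂ] H)) : StarSubalgebra ℂ (H →L[ℂ] H) :=
  (StarAlgebra.adjoin ℂ (Set.range fun g : Γ => (π g : H →L[ℂ] H))).topologicalClosure

theorem rep_mem_groupCStar (π : Γ →* unitary (H →L[ℂ] H)) (g : Γ) :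
    (π g : H →L[ℂ] H) ∈ groupCStar π :=
  StarSubalgebra.le_topologicalClosure _ (StarAlgebra.subset_adjoin ℂ _ ⟨g, rfl⟩)

/-- The unitary `π(g)`, as an element of `C*_π(Γ)`. -/
def groupCStarOf (π : Γ →* unitary (H →L[ℂ] H)) (g : Γ) : groupCStar π :=
  ⟨(π g : H →L[ℂ] H), rep_mem_groupCStar π g⟩

/-- The commutant `A' ⊆ B(H)` of a star subalgebra `A` of `B(H)`. -/
def commutant (A : StarSubalgebra ℂ (H →L[ℂ] H)) : StarSubalgebra ℂ (H →L[ℂ] H) :=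
  StarSubalgebra.centralizer ℂ (A : Set (H →L[ℂ] H))

/-- A state on a unital star subalgebra of `B(H)`: a positive unital linear functional. -/
def IsState {M : StarSubalgebra ℂ (H →L[ℂ] H)} (φ : M →ₗ[ℂ] ℂ) : Prop :=
  φ 1 = 1 ∧ ∀ x : M, 0 ≤ φ (star x * x)

/-- Normality, i.e. σ-weak (ultraweak) continuity: `φ(x) = ∑ₙ ⟪ξₙ, x ηₙ⟫` for two
square-summable sequences of vectors. -/
def IsNormal {M : StarSubalgebra ℂ (H →L[ℂ] H)} (φ : M →ₗ[ℂ] ℂ) : Prop :=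
  ∃ ξ η : ℕ → H, (Summable fun n => ‖ξ n‖ ^ 2) ∧ (Summable fun n => ‖η n‖ ^ 2) ∧
    ∀ x : M, HasSum (fun n => ⟪ξ n, (x : H →L[ℂ] H) (η n)⟫_ℂ) (φ x)

/-- Invariance of a functional on `M` under the action `x ↦ π(g) x π(g)*` of `Γ`. -/
def IsInvariantFunctional (π : Γ →* unitary (H →L[ℂ] H)) {M : StarSubalgebra ℂ (H →L[ℂ] H)}
    (φ : M →ₗ[ℂ] ℂ) : Prop :=
  ∀ (g : Γ) (x y : M),
    (y : H →L[ℂ] H) = (π g : H →L[ℂ] H) * (x : H →L[ℂ] H) * star (π g : H →L[ℂ] H) →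
    φ y = φ x

/-- `A` is co-finite in `C*_π(Γ)`: the commutant `A' ⊆ B(H)` admits a normal `Γ`-invariant state.
(Used for `Γ`-invariant `A`, for which `A'` is `Γ`-invariant as well.) -/
def IsCoFinite (π : Γ →* unitary (H →L[ℂ] H)) (A : StarSubalgebra ℂ (H →L[ℂ] H)) : Prop :=
  ∃ φ : commutant A →ₗ[ℂ] ℂ, IsState φ ∧ IsNormal φ ∧ IsInvariantFunctional π φ

end Representations

section Regular

variable (Γ : Type u) [Group Γ]

theorem memℓp_translate (g : Γ) (f : ℓ²(Γ, ℂ)) :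
    Memℓp (fun h : Γ => f (g⁻¹ * h)) 2 := by
  have h2 : 0 < (2 : ℝ≥0∞).toReal := by norm_num
  have hf := (memℓp_gen_iff h2).1 (lp.memℓp f)
  exact (memℓp_gen_iff h2).2 ((Equiv.mulLeft g⁻¹).summable_iff.2 hf)

/-- Left translation on `ℓ²(Γ)`: `(λ(g) f)(h) = f(g⁻¹ h)`, so that `λ(g) δ_h = δ_{gh}`. -/
def translate (g : Γ) : ℓ²(Γ, ℂ) ≃ₗᵢ[ℂ] ℓ²(Γ, ℂ) where
  toFun f := ⟨fun h => f (g⁻¹ * h), memℓp_translate Γ g f⟩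
  invFun f := ⟨fun h => f (g * h), by
    have h := memℓp_translate Γ g⁻¹ f
    rw [inv_inv] at h
    exact h⟩
  map_add' _ _ := rfl
  map_smul' _ _ := rfl
  left_inv f := by
    apply lp.ext; funext h
    change f (g⁻¹ * (g * h)) = f h
    rw [inv_mul_cancel_left]
  right_inv f := by
    apply lp.ext; funext h
    change f (g * (g⁻¹ * h)) = f h
    rw [mul_inv_cancel_left]
  norm_map' f := by
    have h2 : 0 < (2 : ℝ≥0∞).toReal := by norm_num
    rw [lp.norm_eq_tsum_rpow h2, lp.norm_eq_tsum_rpow h2]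
    congr 1
    exact (Equiv.mulLeft g⁻¹).tsum_eq (fun h => ‖f h‖ ^ (2 : ℝ≥0∞).toReal)

@[simp]
theorem translate_apply (g h : Γ) (f : ℓ²(Γ, ℂ)) : translate Γ g f h = f (g⁻¹ * h) := rfl

/-- The left regular representation `λ_Γ` of `Γ` on `ℓ²(Γ)`. -/
def leftRegular : Γ →* unitary (ℓ²(Γ, ℂ) →L[ℂ] ℓ²(Γ, ℂ)) :=
  (Unitary.linearIsometryEquiv (𝕜 := ℂ) (H := ℓ²(Γ, ℂ))).symm.toMonoidHom.comp
    { toFun := translate Γ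
      map_one' := by
        ext f : 1
        apply lp.ext; funext h
        simp
      map_mul' := fun a b => by
        ext f : 1
        apply lp.ext; funext h
        simp [mul_assoc] }

theorem leftRegular_apply (g h : Γ) (f : ℓ²(Γ, ℂ)) :
    (leftRegular Γ g : ℓ²(Γ, ℂ) →L[ℂ] ℓ²(Γ, ℂ)) f h = f (g⁻¹ * h) := rfl

/-- The reduced group C*-algebra `C*_λ(Γ)`. -/
abbrev ReducedCStar : StarSubalgebra ℂ (ℓ²(Γ, ℂ) →L[ℂ] ℓ²(Γ, ℂ)) :=
  groupCStar (leftRegular Γ)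

/-- The unitary `λ(g)`, as an element of `C*_λ(Γ)`. -/
abbrev regularOf (g : Γ) : ReducedCStar Γ := groupCStarOf (leftRegular Γ) g

variable {Γ} in
/-- `ρ : C*_λ(Γ) → B(H)` is a representation extending `λ(g) ↦ π(g)`. Such a `ρ` exists exactly
when `π` is weakly contained in `λ_Γ`, and it is then unique. -/
def Extends {H : Type v} [NormedAddCommGroup H] [InnerProductSpace ℂ H] [CompleteSpace H]
    (π : Γ →* unitary (H →L[ℂ] H)) (ρ : ReducedCStar Γ →⋆ₐ[ℂ] (H →L[ℂ] H)) : Prop :=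
  ∀ g : Γ, ρ (regularOf Γ g) = (π g : H →L[ℂ] H)

/-- `Γ` is nc-just-infinite: it is infinite, and for every closed `Γ`-invariant unital star
subalgebra `A ≠ ℂ1` of `C*_λ(Γ)` and every unitary representation `π` on a nonzero Hilbert space
that is weakly contained in `λ_Γ`, `π(A)` is co-finite in `C*_π(Γ)`. -/
def IsNCJustInfinite : Prop :=
  Infinite Γ ∧
  ∀ A : StarSubalgebra ℂ (ReducedCStar Γ),
    IsClosed (A : Set (ReducedCStar Γ)) → A ≠ ⊥ →
    (∀ g : Γ, ∀ a ∈ A, regularOf Γ g * a * star (regularOf Γ g) ∈ A) →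
    ∀ (H : Type u) [NormedAddCommGroup H] [InnerProductSpace ℂ H] [CompleteSpace H] [Nontrivial H]
      (π : Γ →* unitary (H →L[ℂ] H)) (ρ : ReducedCStar Γ →⋆ₐ[ℂ] (H →L[ℂ] H)),
      Extends π ρ → IsCoFinite π (A.map ρ)

/-- `Γ` is C*-simple: `C*_λ(Γ)` has no closed two-sided ideals besides `0` and itself. -/
def IsCStarSimple : Prop :=
  ∀ I : TwoSidedIdeal (ReducedCStar Γ), IsClosed (I : Set (ReducedCStar Γ)) → I = ⊥ ∨ I = ⊤

/-- `Γ` is amenable: there is a left-invariant mean on `ℓ^∞(Γ)`. -/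
def IsAmenable : Prop :=
  ∃ m : ℓ^∞(Γ, ℝ) →ₗ[ℝ] ℝ,
    m 1 = 1 ∧ (∀ f : ℓ^∞(Γ, ℝ), (∀ h, 0 ≤ f h) → 0 ≤ m f) ∧
    ∀ (g : Γ) (f f' : ℓ^∞(Γ, ℝ)), (∀ h, f' h = f (g⁻¹ * h)) → m f' = m f

/-- `Γ` is icc: every conjugacy class other than that of `1` is infinite. -/
def IsICC : Prop :=
  ∀ g : Γ, g ≠ 1 → (conjugatesOf g).Infinite

/-- `Γ` is just-infinite: it is infinite and its non-trivial normal subgroups have finite index. -/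
def IsJustInfinite : Prop :=
  Infinite Γ ∧ ∀ N : Subgroup Γ, N.Normal → N ≠ ⊥ → N.FiniteIndex

end Regular

end NCJI

end

/-!
If a representation `π` of `C*_λ(Γ)` kills some `b ≠ 0`, take for `A` the preimage of the scalars
under `π`: then `π(A) = ℂ1` has commutant `B(H)`, and a normal invariant state on `B(H)` is given by
a trace-class operator commuting with `π(Γ)`, whose eigenspaces are finite-dimensional and
invariant. So for an nc-just-infinite group every non-faithful `π ≺ λ` contains a finite-dimensional
subrepresentation. If `C*_λ(Γ)` has a proper closed ideal, Fell absorption turns the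
finite-dimensional representation into a character of `C*_λ(Γ)`, and `Γ` is amenable. If `Γ` has a
non-trivial finite conjugacy class, the centre of `C*_λ(Γ)` has zero divisors `c d = 0`, and
`C*_λ(Γ)` acts on `ker c ⊆ ℓ²(Γ)`, which has no finite-dimensional invariant subspace.

For the simple example, the group of label-preserving automorphisms of the Bass-Serre tree of
`(ℤ/3) * (ℤ/3) * (ℤ/3)` that are almost everywhere translations acts on the half-trees so richly
that the intersection of its non-trivial normal subgroups is simple and non-amenable. It is not
C*-simple, in the manner of Le Boudec: stabilizers of vertices are locally finite, so the
quasi-regular representation on `ℓ²(X)` is weakly contained in `λ`, and it kills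
`(1 - λ(a)) (1 - λ(b))` when `a` and `b` are supported in disjoint half-trees.
-/

noncomputable section

namespace NCJI

open scoped ENNReal ComplexOrder InnerProductSpace lp

universe u v

section States

/-- A contractive unital functional is obtained by Hahn–Banach on `A ⧸ I`, where `1` has norm `1`
because an element at distance less than `1` from `1` is invertible. -/
theorem exists_functional_of_ne_top {A : Type*} [NormedRing A] [NormOneClass A] [CompleteSpace A]
    [NormedAlgebra ℂ A] {I : Ideal A} (hI : I ≠ ⊤) :
    ∃ f : A →L[ℂ] ℂ, ‖f‖ ≤ 1 ∧ f 1 = 1 ∧ ∀ a ∈ I, f a = 0 := by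
  let J : Submodule ℂ A := I.restrictScalars ℂ
  have norm_mk_one : ‖J.mkQ 1‖ = 1 := by
    refine le_antisymm ((Submodule.Quotient.norm_mk_le J 1).trans norm_one.le) ?_
    by_contra! hlt
    obtain ⟨m, hm, hm_lt⟩ := Submodule.Quotient.norm_mk_lt (J.mkQ 1) (sub_pos.2 hlt)
    have hmem : 1 - m ∈ I := (Submodule.Quotient.eq J).1 hm.symm
    refine hI (Ideal.eq_top_of_norm_lt_one I hmem ?_)
    simpa using hm_lt
  obtain ⟨g, hg, hg_one⟩ := exists_dual_vector'' ℂ (J.mkQ 1)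
  refine ⟨LinearMap.mkContinuous (g.toLinearMap ∘ₗ J.mkQ) 1 fun x => ?_,
    LinearMap.mkContinuous_norm_le _ zero_le_one _, ?_, fun a ha => ?_⟩
  · rw [one_mul]
    exact (g.le_of_opNorm_le_of_le hg (Submodule.Quotient.norm_mk_le J x)).trans_eq (one_mul _)
  · exact hg_one.trans (by rw [norm_mk_one, RCLike.ofReal_one])
  · have : J.mkQ a = 0 := (Submodule.Quotient.mk_eq_zero J).2 ha
    simp [this]

variable {A : Type*} [CStarAlgebra A]

theorem norm_add_I_smul_one_sq_le [Nontrivial A] {a : A} (ha : IsSelfAdjoint a) (t : ℝ) :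
    ‖a + (Complex.I * t) • (1 : A)‖ ^ 2 ≤ ‖a‖ ^ 2 + t ^ 2 := by
  have hstar : star (a + (Complex.I * t) • (1 : A)) * (a + (Complex.I * t) • (1 : A)) =
      a * a + ((t ^ 2 : ℝ) : ℂ) • (1 : A) := by
    have hsq : ((t ^ 2 : ℝ) : ℂ) = -(Complex.I * (t : ℂ)) * (Complex.I * t) := by
      push_cast; linear_combination (t : ℂ) ^ 2 * Complex.I_mul_I
    have hconj : star (Complex.I * (t : ℂ)) = -(Complex.I * t) := by simp
    simp only [star_add, star_smul, star_one, ha.star_eq, add_mul, mul_add, smul_mul_assoc,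
      mul_smul_comm, one_mul, mul_one, hconj, hsq]
    module
  rw [sq, ← CStarRing.norm_star_mul_self, hstar]
  refine (norm_add_le _ _).trans ?_
  gcongr
  · rw [sq]; exact norm_mul_le _ _
  · rw [norm_smul, norm_one, mul_one, Complex.norm_real, Real.norm_of_nonneg (sq_nonneg t)]

theorem im_apply_eq_zero_of_isSelfAdjoint {f : A →L[ℂ] ℂ} (hf : ‖f‖ ≤ 1) (h1 : f 1 = 1)
    {a : A} (ha : IsSelfAdjoint a) : (f a).im = 0 := by
  have : Nontrivial A := nontrivial_of_ne 1 0 (ne_of_apply_ne f (by simp [h1]))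
  have bound (t : ℝ) : (f a).im ^ 2 + 2 * (f a).im * t ≤ ‖a‖ ^ 2 := by
    have hle : ‖f a + Complex.I * t‖ ≤ ‖a + (Complex.I * t) • (1 : A)‖ := by
      simpa [h1] using f.le_of_opNorm_le hf (a + (Complex.I * t) • (1 : A))
    have hsq := (pow_le_pow_left₀ (norm_nonneg _) hle 2).trans (norm_add_I_smul_one_sq_le ha t)
    rw [← Complex.normSq_eq_norm_sq, Complex.normSq_apply] at hsq
    simp only [Complex.add_re, Complex.add_im, Complex.re_mul_ofReal, Complex.im_mul_ofReal,
      Complex.I_re, Complex.I_im] at hsq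
    nlinarith [sq_nonneg (f a).re]
  by_contra hne
  have h := bound ((‖a‖ ^ 2 + 1) / (2 * (f a).im))
  rw [mul_div_cancel₀ _ (by simpa using hne)] at h
  nlinarith [sq_nonneg (f a).im]

theorem apply_nonneg_of_norm_le_one [PartialOrder A] [StarOrderedRing A] {f : A →L[ℂ] ℂ}
    (hf : ‖f‖ ≤ 1) (h1 : f 1 = 1) {a : A} (ha : 0 ≤ a) : 0 ≤ f a := by
  have : Nontrivial A := nontrivial_of_ne 1 0 (ne_of_apply_ne f (by simp [h1]))
  have hsa : IsSelfAdjoint a := IsSelfAdjoint.of_nonneg ha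
  have norm_sub_le : ‖algebraMap ℝ A ‖a‖ - a‖ ≤ ‖a‖ := by
    simpa using CStarAlgebra.norm_le_norm_of_nonneg_of_le
      (sub_nonneg.2 hsa.le_algebraMap_norm_self) (sub_le_self _ ha)
  have apply_sub : f (algebraMap ℝ A ‖a‖ - a) = (‖a‖ : ℂ) - f a := by
    rw [map_sub, Algebra.algebraMap_eq_smul_one, ← Complex.coe_smul, map_smul, h1, smul_eq_mul,
      mul_one]
  have re_le : |((‖a‖ : ℂ) - f a).re| ≤ ‖a‖ := by
    refine (Complex.abs_re_le_norm _).trans ?_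
    rw [← apply_sub]
    exact (f.le_of_opNorm_le_of_le hf norm_sub_le).trans_eq (one_mul _)
  rw [Complex.sub_re, Complex.ofReal_re] at re_le
  refine Complex.nonneg_iff.2 ⟨?_, (im_apply_eq_zero_of_isSelfAdjoint hf h1 hsa).symm⟩
  linarith [(abs_le.1 re_le).2]

theorem gnsStarAlgHom_eq_zero [PartialOrder A] [StarOrderedRing A] (φ : A →ₚ[ℂ] ℂ)
    {I : TwoSidedIdeal A} (hφ : ∀ a ∈ I, φ a = 0) {a : A} (ha : a ∈ I) :
    φ.gnsStarAlgHom a = 0 := by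
  ext x
  induction x using UniformSpace.Completion.induction_on with
  | hp => apply isClosed_eq <;> fun_prop
  | ih x =>
    change φ.gnsNonUnitalStarAlgHom a x = 0
    rw [PositiveLinearMap.gnsNonUnitalStarAlgHom_apply_coe, ← norm_eq_zero,
      UniformSpace.Completion.norm_coe, PositiveLinearMap.preGNS_norm_def, hφ]
    · simp
    · exact I.mul_mem_left _ _ (I.mul_mem_right a (φ.ofPreGNS x) ha)

end States

theorem exists_representation_of_ideal {A : Type u} [CStarAlgebra A] {I : TwoSidedIdeal A}
    (hI : I ≠ ⊤) :
    ∃ (H : Type u) (_ : NormedAddCommGroup H) (_ : InnerProductSpace ℂ H) (_ : CompleteSpace H)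
      (_ : Nontrivial H) (ρ : A →⋆ₐ[ℂ] (H →L[ℂ] H)), ∀ a ∈ I, ρ a = 0 := by
  let _ : PartialOrder A := CStarAlgebra.spectralOrder A
  have _ : StarOrderedRing A := CStarAlgebra.spectralOrderedRing A
  have hne : TwoSidedIdeal.asIdeal I ≠ ⊤ := fun h =>
    hI (top_le_iff.1 fun x _ => TwoSidedIdeal.mem_asIdeal.1 (h ▸ Submodule.mem_top))
  have : Nontrivial A := nontrivial_of_ne 1 0 fun h =>
    hne ((Ideal.eq_top_iff_one _).2 (h ▸ zero_mem _))
  obtain ⟨f, hf, h1, hfI⟩ := exists_functional_of_ne_top hne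
  let φ : A →ₚ[ℂ] ℂ := PositiveLinearMap.mk₀ f.toLinearMap
    fun x hx => apply_nonneg_of_norm_le_one hf h1 hx
  have hφ (x : A) : φ x = f x := rfl
  have norm_one_gns : ‖((φ.toPreGNS 1 : φ.PreGNS) : φ.GNS)‖ ≠ 0 := by
    rw [UniformSpace.Completion.norm_coe, PositiveLinearMap.preGNS_norm_def]
    simp [hφ, h1]
  exact ⟨φ.GNS, inferInstance, inferInstance, inferInstance,
    nontrivial_of_ne _ 0 (norm_ne_zero_iff.1 norm_one_gns), φ.gnsStarAlgHom,
    fun a ha => gnsStarAlgHom_eq_zero φ hfI ha⟩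

section NormalStates

open InnerProductSpace

variable {H : Type v} [NormedAddCommGroup H] [InnerProductSpace ℂ H]

theorem summable_mul_of_summable_sq {ι : Type*} {f g : ι → ℝ} (hf : Summable fun i => f i ^ 2)
    (hg : Summable fun i => g i ^ 2) : Summable fun i => f i * g i := by
  refine Summable.of_norm_bounded (hf.add hg) fun i => ?_
  rw [Real.norm_eq_abs, abs_le]
  constructor <;> nlinarith [sq_nonneg (f i - g i), sq_nonneg (f i + g i)]

theorem hasSum_norm_inner_sq {ι : Type*} (b : HilbertBasis ι ℂ H) (v : H) :
    HasSum (fun i => ‖⟪b i, v⟫_ℂ‖ ^ 2) (‖v‖ ^ 2) := by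
  have h := Complex.hasSum_re (b.hasSum_inner_mul_inner v v)
  rw [show (⟪v, v⟫_ℂ).re = ‖v‖ ^ 2 from inner_self_eq_norm_sq (𝕜 := ℂ) v] at h
  convert h using 2 with i
  rw [← inner_conj_symm v (b i), ← Complex.normSq_eq_conj_mul_self, Complex.ofReal_re,
    Complex.normSq_eq_norm_sq]

theorem summable_norm_inner_sq {ι κ : Type*} (b : HilbertBasis κ ℂ H) {ζ : ι → H}
    (hζ : Summable fun n => ‖ζ n‖ ^ 2) :
    Summable fun p : ι × κ => ‖⟪b p.2, ζ p.1⟫_ℂ‖ ^ 2 := by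
  rw [summable_prod_of_nonneg fun p => by positivity]
  refine ⟨fun n => (hasSum_norm_inner_sq b (ζ n)).summable, ?_⟩
  simpa only [(hasSum_norm_inner_sq b (ζ _)).tsum_eq] using hζ

/-- The trace-class operator `∑ₙ |ηₙ⟩⟨ξₙ|`, which represents the normal functional
`x ↦ ∑ₙ ⟪ξₙ, x ηₙ⟫` as `x ↦ Tr(x T)`. It has the junk value `0` if the series does not converge in
norm. -/
def densityOperator (ξ η : ℕ → H) : H →L[ℂ] H := ∑' n, rankOne ℂ (η n) (ξ n)

variable [CompleteSpace H] {ξ η : ℕ → H} (hξ : Summable fun n => ‖ξ n‖ ^ 2)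
  (hη : Summable fun n => ‖η n‖ ^ 2)

include hξ hη

theorem hasSum_densityOperator : HasSum (fun n => rankOne ℂ (η n) (ξ n)) (densityOperator ξ η) :=
  (Summable.of_norm (by
    simpa only [norm_rankOne] using summable_mul_of_summable_sq hη hξ)).hasSum

theorem isCompactOperator_densityOperator : IsCompactOperator (densityOperator ξ η) := by
  refine isCompactOperator_of_tendsto (hasSum_densityOperator hξ hη)
    (Filter.Eventually.of_forall fun s => ?_)
  refine (compactOperator (RingHom.id ℂ) H H).sum_mem fun n _ => ?_
  change IsCompactOperator (rankOne ℂ (η n) (ξ n) : H →L[ℂ] H)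
  rw [rankOne_def']
  exact (isCompactOperator_of_locallyCompactSpace_dom (innerSL ℂ (ξ n))).clm_comp
    (ContinuousLinearMap.toSpanSingleton ℂ (η n))

theorem hasSum_inner_densityOperator (v w : H) :
    HasSum (fun n => ⟪ξ n, rankOne ℂ v w (η n)⟫_ℂ) ⟪w, densityOperator ξ η v⟫_ℂ := by
  have h := (hasSum_densityOperator hξ hη).mapL
    ((innerSL ℂ w).comp (ContinuousLinearMap.apply ℂ H v))
  simpa [mul_comm] using h

/-- The trace of `densityOperator ξ η` is computed along its defining series and along a Hilbert
basis; the resulting double series converges absolutely. -/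
theorem hasSum_inner_of_densityOperator_eq_zero (hT : densityOperator ξ η = 0) :
    HasSum (fun n => ⟪ξ n, η n⟫_ℂ) 0 := by
  obtain ⟨ι, b, -⟩ := exists_hilbertBasis ℂ H
  let a : ℕ × ι → ℂ := fun p => ⟪ξ p.1, b p.2⟫_ℂ * ⟪b p.2, η p.1⟫_ℂ
  have ha : Summable a := by
    refine Summable.of_norm ?_
    simpa only [a, norm_mul, norm_inner_symm (ξ _)] using
      summable_mul_of_summable_sq (summable_norm_inner_sq b hξ) (summable_norm_inner_sq b hη)
  have sum_over_basis_first : HasSum (fun n => ⟪ξ n, η n⟫_ℂ) (∑' p, a p) :=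
    ha.hasSum.prod_fiberwise fun n => b.hasSum_inner_mul_inner (ξ n) (η n)
  have sum_over_series_first : HasSum (fun _ : ι => (0 : ℂ)) (∑' p, a p) := by
    refine ((Equiv.prodComm ι ℕ).hasSum_iff.2 ha.hasSum).prod_fiberwise fun i => ?_
    simpa [a, hT, mul_comm] using hasSum_inner_densityOperator hξ hη (b i) (b i)
  rwa [sum_over_series_first.unique hasSum_zero] at sum_over_basis_first

variable {φ : (H →L[ℂ] H) → ℂ} (hφ : ∀ x : H →L[ℂ] H, HasSum (fun n => ⟪ξ n, x (η n)⟫_ℂ) (φ x))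

include hφ

theorem apply_rankOne_eq_inner_densityOperator (v w : H) :
    φ (rankOne ℂ v w) = ⟪w, densityOperator ξ η v⟫_ℂ :=
  (hφ _).unique (hasSum_inner_densityOperator hξ hη v w)

theorem densityOperator_ne_zero (h1 : φ 1 = 1) : densityOperator ξ η ≠ 0 := fun h0 =>
  one_ne_zero (h1 ▸ (hφ 1).unique (hasSum_inner_of_densityOperator_eq_zero hξ hη h0))

theorem inner_densityOperator_nonneg (hpos : ∀ x, 0 ≤ φ (star x * x)) (v : H) :
    0 ≤ ⟪v, densityOperator ξ η v⟫_ℂ := by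
  rcases eq_or_ne v 0 with rfl | hv
  · simp
  set e : H := ((‖v‖⁻¹ : ℝ) : ℂ) • v with he
  have norm_e : ‖e‖ = 1 := by simp [he, norm_smul, hv]
  have hsq : star (rankOne ℂ e v : H →L[ℂ] H) * rankOne ℂ e v = rankOne ℂ v v := by
    rw [ContinuousLinearMap.star_eq_adjoint, adjoint_rankOne]
    ext z
    simp [norm_e]
  rw [← apply_rankOne_eq_inner_densityOperator hξ hη hφ, ← hsq]
  exact hpos _

theorem isSymmetric_densityOperator (hpos : ∀ x, 0 ≤ φ (star x * x)) :
    (densityOperator ξ η).IsSymmetric := by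
  refine (LinearMap.isSymmetric_iff_inner_map_self_real _).2 fun v => ?_
  have hreal := Complex.nonneg_iff.1 (inner_densityOperator_nonneg hξ hη hφ hpos v)
  rw [inner_conj_symm]
  exact ((Complex.conj_eq_iff_im.2 hreal.2.symm).symm).trans (inner_conj_symm _ _)

theorem densityOperator_apply_comm {U : H →L[ℂ] H} (hU : U ∈ unitary (H →L[ℂ] H))
    (hinv : ∀ x, φ (U * x * star U) = φ x) (v : H) :
    densityOperator ξ η (U v) = U (densityOperator ξ η v) := by
  refine ext_inner_left ℂ fun w => ?_
  have conj_rankOne : U * rankOne ℂ v (star U w) * star U = rankOne ℂ (U v) w := by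
    ext z
    have hz : U (star U z) = z := DFunLike.congr_fun (Unitary.mul_star_self_of_mem hU) z
    simp only [mul_apply_eq_comp, rankOne_apply, map_smul]
    rw [ContinuousLinearMap.star_eq_adjoint, ContinuousLinearMap.adjoint_inner_left,
      ← ContinuousLinearMap.star_eq_adjoint, hz]
  rw [← apply_rankOne_eq_inner_densityOperator hξ hη hφ, ← conj_rankOne, hinv,
    apply_rankOne_eq_inner_densityOperator hξ hη hφ, ContinuousLinearMap.star_eq_adjoint,
    ContinuousLinearMap.adjoint_inner_left]

/-- The subspace is an eigenspace of the density operator for a nonzero eigenvalue. -/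
theorem exists_finiteDimensional_of_normal_invariant_state (h1 : φ 1 = 1)
    (hpos : ∀ x, 0 ≤ φ (star x * x)) {Γ : Type u} [Group Γ] (π : Γ →* unitary (H →L[ℂ] H))
    (hinv : ∀ (g : Γ) (x : H →L[ℂ] H),
      φ ((π g : H →L[ℂ] H) * x * star (π g : H →L[ℂ] H)) = φ x) :
    ∃ V : Submodule ℂ H, FiniteDimensional ℂ V ∧ V ≠ ⊥ ∧
      ∀ (g : Γ), ∀ v ∈ V, (π g : H →L[ℂ] H) v ∈ V := by
  set T := densityOperator ξ η
  have hcompact : IsCompactOperator T := isCompactOperator_densityOperator hξ hη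
  have hsymm : T.IsSymmetric := isSymmetric_densityOperator hξ hη hφ hpos
  obtain ⟨μ, hμ, hμ0⟩ : ∃ μ, Module.End.HasEigenvalue (T : Module.End ℂ H) μ ∧ μ ≠ 0 := by
    by_contra! h
    exact densityOperator_ne_zero hξ hη hφ h1
      ((ContinuousLinearMap.eq_zero_of_forall_hasEigenvalue_eq_zero hcompact hsymm).1 h)
  refine ⟨Module.End.eigenspace (T : Module.End ℂ H) μ,
    ContinuousLinearMap.finite_dimensional_eigenspace hcompact μ hμ0, hμ, fun g v hv => ?_⟩
  rw [Module.End.mem_eigenspace_iff] at hv ⊢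
  change T _ = _
  change T v = _ at hv
  rw [densityOperator_apply_comm hξ hη hφ (π g).2 (hinv g), hv, map_smul]

end NormalStates

section GroupCStar

variable {Γ : Type u} [Group Γ]
variable {H : Type v} [NormedAddCommGroup H] [InnerProductSpace ℂ H] [CompleteSpace H]
variable (π : Γ →* unitary (H →L[ℂ] H))

instance isClosed_groupCStar : IsClosed (groupCStar π : Set (H →L[ℂ] H)) :=
  StarSubalgebra.isClosed_topologicalClosure _

theorem groupCStarOf_one : groupCStarOf π 1 = 1 := by
  apply Subtype.ext
  simp [groupCStarOf]

theorem groupCStarOf_mul (g h : Γ) :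
    groupCStarOf π (g * h) = groupCStarOf π g * groupCStarOf π h := by
  apply Subtype.ext
  simp [groupCStarOf]

theorem star_rep (g : Γ) : star (π g : H →L[ℂ] H) = π g⁻¹ := by
  rw [map_inv, ← Unitary.star_eq_inv, Unitary.coe_star]

theorem star_groupCStarOf (g : Γ) : star (groupCStarOf π g) = groupCStarOf π g⁻¹ :=
  Subtype.ext (star_rep π g)

theorem groupCStarOf_mem_unitary (g : Γ) : groupCStarOf π g ∈ unitary (groupCStar π) := by
  rw [Unitary.mem_iff, star_groupCStarOf, ← groupCStarOf_mul, ← groupCStarOf_mul]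
  simp [groupCStarOf_one]

theorem coe_groupCStar : (groupCStar π : Set (H →L[ℂ] H)) =
    closure (Submodule.span ℂ (Set.range fun g => (π g : H →L[ℂ] H))) := by
  let U : Γ →* (H →L[ℂ] H) := (unitary (H →L[ℂ] H)).subtype.comp π
  have star_range : star (Set.range U) = Set.range U := by
    rw [← Set.image_star, ← Set.range_comp, ← (Equiv.inv Γ).surjective.range_comp U]
    exact congrArg Set.range (funext (star_rep π))
  have adjoin_eq : (StarAlgebra.adjoin ℂ (Set.range U) : Set (H →L[ℂ] H)) =
      Submodule.span ℂ (Set.range U) := by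
    rw [← StarSubalgebra.coe_toSubalgebra, ← Subalgebra.coe_toSubmodule,
      StarAlgebra.adjoin_eq_span, star_range, Set.union_self, ← MonoidHom.coe_mrange,
      Submonoid.closure_eq]
  exact congrArg closure adjoin_eq

theorem dense_span_groupCStarOf :
    Dense (Submodule.span ℂ (Set.range (groupCStarOf π)) : Set (groupCStar π)) := by
  intro x
  have image_span : (Submodule.span ℂ (Set.range (groupCStarOf π))).map
      (groupCStar π).subtype.toLinearMap =
        Submodule.span ℂ (Set.range fun g => (π g : H →L[ℂ] H)) := by
    rw [Submodule.map_span, ← Set.range_comp]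
    rfl
  have hx : (x : H →L[ℂ] H) ∈ closure _ := (coe_groupCStar π).subset x.2
  rw [← image_span] at hx
  exact closure_subtype.2 hx

variable {π}

theorem groupCStar_clm_ext {E : Type*} [NormedAddCommGroup E] [NormedSpace ℂ E]
    {S T : groupCStar π →L[ℂ] E} (h : ∀ g, S (groupCStarOf π g) = T (groupCStarOf π g)) :
    S = T :=
  ContinuousLinearMap.ext_on (dense_span_groupCStarOf π) (by rintro _ ⟨g, rfl⟩; exact h g)

end GroupCStar

section ScalarPreimage

theorem isClosed_bot_starSubalgebra {A : Type*} [CStarAlgebra A] :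
    IsClosed ((⊥ : StarSubalgebra ℂ A) : Set A) := by
  have coe_bot : ((⊥ : StarSubalgebra ℂ A) : Set A) = Submodule.span ℂ {(1 : A)} := by
    ext x
    rw [SetLike.mem_coe, StarSubalgebra.mem_bot, SetLike.mem_coe, Submodule.mem_span_singleton]
    simp [Algebra.algebraMap_eq_smul_one]
  rw [coe_bot]
  exact Submodule.closed_of_finiteDimensional _

theorem comap_bot_ne_bot {A B : Type*} [Ring A] [StarRing A] [Algebra ℂ A] [StarModule ℂ A]
    [Ring B] [StarRing B] [Algebra ℂ B] [StarModule ℂ B] [Nontrivial B] {ρ : A →⋆ₐ[ℂ] B} {b : A}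
    (hb : b ≠ 0) (hρb : ρ b = 0) : (⊥ : StarSubalgebra ℂ B).comap ρ ≠ ⊥ := by
  intro h
  have hmem : b ∈ (⊥ : StarSubalgebra ℂ B).comap ρ := by
    rw [StarSubalgebra.mem_comap, hρb]
    exact zero_mem _
  rw [h, StarSubalgebra.mem_bot] at hmem
  obtain ⟨c, rfl⟩ := hmem
  rw [AlgHomClass.commutes, map_eq_zero_iff _ (FaithfulSMul.algebraMap_injective ℂ B)] at hρb
  exact hb (by rw [hρb, map_zero])

theorem conj_mem_bot {A : Type*} [Ring A] [StarRing A] [Algebra ℂ A] [StarModule ℂ A] {u a : A}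
    (hu : u ∈ unitary A) (ha : a ∈ (⊥ : StarSubalgebra ℂ A)) :
    u * a * star u ∈ (⊥ : StarSubalgebra ℂ A) := by
  obtain ⟨c, rfl⟩ := StarSubalgebra.mem_bot.1 ha
  rw [← Algebra.commutes, mul_assoc, Unitary.mul_star_self_of_mem hu, mul_one]
  exact ha

variable {H : Type v} [NormedAddCommGroup H] [InnerProductSpace ℂ H] [CompleteSpace H]

theorem mem_commutant_of_le_bot {A : StarSubalgebra ℂ (H →L[ℂ] H)} (hA : A ≤ ⊥)
    (x : H →L[ℂ] H) : x ∈ commutant A := by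
  refine (StarSubalgebra.mem_centralizer_iff ℂ).2 fun y hy => ?_
  obtain ⟨c, rfl⟩ := StarSubalgebra.mem_bot.1 (hA hy)
  rw [← algebraMap_star_comm]
  exact ⟨Algebra.commutes _ _, Algebra.commutes _ _⟩

end ScalarPreimage

section RepresentationsOfReducedCStar

open scoped CStarAlgebra

variable {Γ : Type u} [Group Γ]
variable {H : Type v} [NormedAddCommGroup H] [InnerProductSpace ℂ H] [CompleteSpace H]

/-- The unitary representation `g ↦ ρ(λ(g))` obtained from a representation `ρ` of `C*_λ(Γ)`; these
are exactly the representations weakly contained in `λ`. -/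
def unitaryRep (ρ : ReducedCStar Γ →⋆ₐ[ℂ] (H →L[ℂ] H)) : Γ →* unitary (H →L[ℂ] H) where
  toFun g := ⟨ρ (regularOf Γ g), Unitary.map_mem ρ (groupCStarOf_mem_unitary _ g)⟩
  map_one' := by
    apply Subtype.ext
    simp [groupCStarOf_one]
  map_mul' g h := by
    apply Subtype.ext
    simp [groupCStarOf_mul]

/-- The subalgebra `A = ρ⁻¹(ℂ1)` is not `ℂ1`, and the commutant of `ρ(A) ⊆ ℂ1` is all of `B(H)`. -/
theorem IsNCJustInfinite.exists_finiteDimensional {H : Type u} [NormedAddCommGroup H]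
    [InnerProductSpace ℂ H] [CompleteSpace H] [Nontrivial H] (hΓ : IsNCJustInfinite Γ)
    (ρ : ReducedCStar Γ →⋆ₐ[ℂ] (H →L[ℂ] H)) {b : ReducedCStar Γ} (hb : b ≠ 0) (hρb : ρ b = 0) :
    ∃ V : Submodule ℂ H, FiniteDimensional ℂ V ∧ V ≠ ⊥ ∧
      ∀ (g : Γ), ∀ v ∈ V, (unitaryRep ρ g : H →L[ℂ] H) v ∈ V := by
  set A : StarSubalgebra ℂ (ReducedCStar Γ) := (⊥ : StarSubalgebra ℂ (H →L[ℂ] H)).comap ρ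
  have hclosed : IsClosed (A : Set (ReducedCStar Γ)) :=
    isClosed_bot_starSubalgebra.preimage (map_continuous ρ)
  have hinv (g : Γ) (a) (ha : a ∈ A) : regularOf Γ g * a * star (regularOf Γ g) ∈ A := by
    rw [StarSubalgebra.mem_comap, map_mul, map_mul, map_star]
    exact conj_mem_bot (unitaryRep ρ g).2 ha
  obtain ⟨φ, ⟨hφ1, hφpos⟩, ⟨ξ, η, hξ, hη, hsum⟩, hφinv⟩ :=
    hΓ.2 A hclosed (comap_bot_ne_bot hb hρb) hinv H (unitaryRep ρ) ρ fun _ => rfl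
  have hcomm := mem_commutant_of_le_bot (StarSubalgebra.map_le_iff_le_comap.2 (le_refl A))
  exact exists_finiteDimensional_of_normal_invariant_state (φ := fun x => φ ⟨x, hcomm x⟩) hξ hη
    (fun x => hsum ⟨x, hcomm x⟩) hφ1 (fun x => hφpos ⟨x, hcomm x⟩) (unitaryRep ρ)
    (fun g x => hφinv g ⟨x, hcomm x⟩ _ rfl)

end RepresentationsOfReducedCStar

section MultiplicationOperators

variable {ι : Type*}

/-- The action of `ℓ^∞` on `ℓ²` by pointwise multiplication. -/
def mulOp : ℓ^∞(ι, ℂ) →L[ℂ] (ℓ²(ι, ℂ) →L[ℂ] ℓ²(ι, ℂ)) :=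
  lp.holderL 2 (fun _ => ContinuousLinearMap.mul ℂ ℂ) (K := 1)
    fun _ => ContinuousLinearMap.opNorm_mul_le ℂ ℂ

@[simp]
theorem mulOp_apply (f : ℓ^∞(ι, ℂ)) (v : ℓ²(ι, ℂ)) (i : ι) : mulOp f v i = f i * v i := rfl

theorem mulOp_one : mulOp (1 : ℓ^∞(ι, ℂ)) = 1 := by
  ext v i
  simp

theorem mulOp_nonneg {f : ℓ^∞(ι, ℂ)} (hf : ∀ i, 0 ≤ f i) : 0 ≤ mulOp f := by
  rw [ContinuousLinearMap.nonneg_iff_isPositive, ContinuousLinearMap.isPositive_iff_complex]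
  intro v
  have inner_apply_nonneg (i : ι) : 0 ≤ ⟪mulOp f v i, v i⟫_ℂ := by
    rw [mulOp_apply, RCLike.inner_apply, map_mul,
      Complex.conj_eq_iff_im.2 (Complex.nonneg_iff.1 (hf i)).2.symm, mul_left_comm,
      Complex.mul_conj]
    exact mul_nonneg (hf i) (Complex.zero_le_real.2 (Complex.normSq_nonneg _))
  have inner_nonneg : 0 ≤ ⟪mulOp f v, v⟫_ℂ := (lp.hasSum_inner _ _).nonneg inner_apply_nonneg
  obtain ⟨hre, him⟩ := Complex.nonneg_iff.1 inner_nonneg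
  exact ⟨Complex.ext rfl (by simpa using him), hre⟩

theorem leftRegular_mul_mulOp {Γ : Type u} [Group Γ] (g : Γ) {f f' : ℓ^∞(Γ, ℂ)}
    (hff' : ∀ h, f' h = f (g⁻¹ * h)) :
    (leftRegular Γ g : ℓ²(Γ, ℂ) →L[ℂ] ℓ²(Γ, ℂ)) * mulOp f =
      mulOp f' * (leftRegular Γ g : ℓ²(Γ, ℂ) →L[ℂ] ℓ²(Γ, ℂ)) := by
  ext v h
  simp only [mul_apply_eq_comp, mulOp_apply, leftRegular_apply, hff']

end MultiplicationOperators

section Characters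

variable {A : Type*} [CStarAlgebra A] [PartialOrder A] [StarOrderedRing A]

theorem apply_mul_eq_zero_of_apply_star_mul_self (φ : A →ₚ[ℂ] ℂ) {d : A}
    (hd : φ (star d * d) = 0) (x : A) : φ (x * d) = 0 := by
  have h := norm_inner_le_norm (𝕜 := ℂ) (φ.toPreGNS (star x)) (φ.toPreGNS d)
  rw [PositiveLinearMap.preGNS_norm_def _ (φ.toPreGNS d), PositiveLinearMap.preGNS_inner_def] at h
  simpa [hd] using h

/-- The multiplicative domain trick: `d = 1 - u` satisfies `φ(d* d) = 2 - 2 Re φ(u) = 0`. -/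
theorem apply_mul_of_mem_unitary (φ : A →ₚ[ℂ] ℂ) (h1 : φ 1 = 1) {u : A} (hu : u ∈ unitary A)
    (hφu : φ u = 1) (x : A) : φ (x * u) = φ x := by
  have hd : φ (star (1 - u) * (1 - u)) = 0 := by
    rw [star_sub, star_one, sub_mul, one_mul, mul_sub, mul_one, Unitary.star_mul_self_of_mem hu,
      map_sub, map_sub, map_sub, map_star, hφu, h1]
    simp
  have h := apply_mul_eq_zero_of_apply_star_mul_self φ hd x
  rw [mul_sub, mul_one, map_sub] at h
  exact (sub_eq_zero.1 h).symm

theorem apply_mul_of_mem_unitary_left (φ : A →ₚ[ℂ] ℂ) (h1 : φ 1 = 1) {u : A}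
    (hu : u ∈ unitary A) (hφu : φ u = 1) (x : A) : φ (u * x) = φ x := by
  have h := apply_mul_of_mem_unitary φ h1 (Unitary.star_mem hu)
    (by rw [map_star, hφu, star_one]) (star x)
  rwa [← star_mul, map_star, map_star, star_inj] at h

variable {Γ : Type u} [Group Γ]

theorem norm_le_one_of_apply_groupCStarOf {H : Type v} [NormedAddCommGroup H]
    [InnerProductSpace ℂ H] [CompleteSpace H] {π : Γ →* unitary (H →L[ℂ] H)} (χ : Γ →* ℂ)
    {E : groupCStar π →L[ℂ] ℂ} (hE : ∀ g, E (groupCStarOf π g) = χ g) : ‖E‖ ≤ 1 := by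
  have map_one_eq : E 1 = 1 := by rw [← groupCStarOf_one, hE, map_one]
  have map_of_mul (g : Γ) (y) : E (groupCStarOf π g * y) = χ g * E y := by
    have h : E.comp (ContinuousLinearMap.mul ℂ (groupCStar π) (groupCStarOf π g)) = χ g • E :=
      groupCStar_clm_ext fun h => by
        change E (groupCStarOf π g * groupCStarOf π h) = χ g * E (groupCStarOf π h)
        rw [← groupCStarOf_mul, hE, hE, map_mul]
    exact DFunLike.congr_fun h y
  have map_mul_eq (x y) : E (x * y) = E x * E y := by
    have h : E.comp ((ContinuousLinearMap.mul ℂ (groupCStar π)).flip y) = E y • E :=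
      groupCStar_clm_ext fun g => by
        change E (groupCStarOf π g * y) = E y * E (groupCStarOf π g)
        rw [map_of_mul, hE, mul_comm]
    exact (DFunLike.congr_fun h x).trans (mul_comm _ _)
  have : Nontrivial (groupCStar π) := nontrivial_of_ne 1 0 (ne_of_apply_ne E (by simp [map_one_eq]))
  refine E.opNorm_le_bound zero_le_one fun x => ?_
  rw [one_mul]
  exact AlgHom.norm_apply_le_self (AlgHom.ofLinearMap E.toLinearMap map_one_eq map_mul_eq) x

/-- A state on `B(ℓ²(Γ))` that is `1` on every `λ(g)` restricts to an invariant mean on the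
multiplication operators. -/
theorem isAmenable_of_state
    (φ : (ℓ²(Γ, ℂ) →L[ℂ] ℓ²(Γ, ℂ)) →ₚ[ℂ] ℂ) (hφ : ∀ g, φ (leftRegular Γ g) = 1) :
    IsAmenable Γ := by
  have map_one_eq : φ 1 = 1 := by simpa using hφ 1
  let ofReal : ℓ^∞(Γ, ℝ) →L[ℝ] ℓ^∞(Γ, ℂ) :=
    lp.mapCLM ∞ (fun _ => Complex.ofRealCLM) zero_le_one fun _ => Complex.ofRealCLM_norm.le
  let mean : ℓ^∞(Γ, ℝ) →ₗ[ℝ] ℝ := Complex.reLm ∘ₗ (φ.toLinearMap.restrictScalars ℝ) ∘ₗ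
    (mulOp (ι := Γ)).toLinearMap.restrictScalars ℝ ∘ₗ ofReal.toLinearMap
  have mean_apply (f) : mean f = (φ (mulOp (ofReal f))).re := rfl
  have ofReal_apply (f : ℓ^∞(Γ, ℝ)) (h : Γ) : ofReal f h = f h := rfl
  refine ⟨mean, ?_, fun f hf => ?_, fun g f f' hff' => ?_⟩
  · have ofReal_one : ofReal 1 = 1 := by
      ext h
      simp [ofReal_apply]
    rw [mean_apply, ofReal_one, mulOp_one, map_one_eq, Complex.one_re]
  · have hnonneg : 0 ≤ mulOp (ofReal f) :=
      mulOp_nonneg fun h => by simpa only [ofReal_apply, Complex.zero_le_real] using hf h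
    exact (Complex.nonneg_iff.1 (φ.map_nonneg hnonneg)).1
  · rw [mean_apply, mean_apply,
      ← apply_mul_of_mem_unitary φ map_one_eq (leftRegular Γ g).2 (hφ g) (mulOp (ofReal f')),
      ← apply_mul_of_mem_unitary_left φ map_one_eq (leftRegular Γ g).2 (hφ g) (mulOp (ofReal f)),
      leftRegular_mul_mulOp g fun h => by rw [ofReal_apply, ofReal_apply, hff' h]]

theorem isAmenable_of_functional {E : ReducedCStar Γ →L[ℂ] ℂ} (hE : ∀ g, E (regularOf Γ g) = 1) :
    IsAmenable Γ := by
  obtain ⟨ψ, hψE, hψ_norm⟩ := exists_extension_norm_eq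
    (Subalgebra.toSubmodule (ReducedCStar Γ).toSubalgebra) E
  have hψ (g : Γ) : ψ (leftRegular Γ g) = 1 := (hψE (regularOf Γ g)).trans (hE g)
  have hψ_le : ‖ψ‖ ≤ 1 := hψ_norm.trans_le (norm_le_one_of_apply_groupCStarOf (1 : Γ →* ℂ) hE)
  exact isAmenable_of_state (PositiveLinearMap.mk₀ ψ.toLinearMap fun x hx =>
    apply_nonneg_of_norm_le_one hψ_le (by simpa using hψ 1) hx) hψ

end Characters

section FiniteDimensionalRepresentations

variable {Γ : Type u} [Group Γ]
variable {H : Type v} [NormedAddCommGroup H] [InnerProductSpace ℂ H] [CompleteSpace H]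

theorem exists_multiplier_groupCStar {π : Γ →* unitary (H →L[ℂ] H)}
    {Y : (H →L[ℂ] H) →L[ℂ] (H →L[ℂ] H)} {c : Γ → ℂ} (hY : ∀ g, Y (π g) = c g • (π g : H →L[ℂ] H)) :
    ∃ Z : groupCStar π →L[ℂ] groupCStar π, ∀ g, Z (groupCStarOf π g) = c g • groupCStarOf π g := by
  have span_le : Submodule.span ℂ (Set.range fun g => (π g : H →L[ℂ] H)) ≤
      (groupCStar π).toSubmodule.comap Y.toLinearMap := by
    rw [Submodule.span_le]
    rintro _ ⟨g, rfl⟩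
    change Y (π g) ∈ groupCStar π
    rw [hY]
    exact (groupCStar π).smul_mem (rep_mem_groupCStar π g) _
  have mapsTo (x : H →L[ℂ] H) (hx : x ∈ (groupCStar π).toSubmodule) :
      Y x ∈ (groupCStar π).toSubmodule :=
    closure_minimal span_le ((isClosed_groupCStar π).preimage Y.continuous)
      ((coe_groupCStar π).subset hx)
  exact ⟨Y.restrict mapsTo, fun g => Subtype.ext (hY g)⟩

/-- The matrix coefficient `g ↦ ⟪v, π(g) w⟫` of a unitary representation, as an element of
`ℓ^∞(Γ)`. -/
def matrixCoeff (π : Γ →* unitary (H →L[ℂ] H)) (v w : H) : ℓ^∞(Γ, ℂ) :=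
  ⟨fun g => ⟪v, (π g : H →L[ℂ] H) w⟫_ℂ, memℓp_infty ⟨‖v‖ * ‖w‖, by
    rintro _ ⟨g, rfl⟩
    have hw : ‖(π g : H →L[ℂ] H) w‖ = ‖w‖ := Unitary.norm_map (π g) w
    exact (norm_inner_le_norm _ _).trans_eq (by rw [hw])⟩⟩

variable {π : Γ →* unitary (H →L[ℂ] H)}

theorem matrixCoeff_apply (v w : H) (g : Γ) :
    matrixCoeff π v w g = ⟪v, (π g : H →L[ℂ] H) w⟫_ℂ := rfl

theorem star_matrixCoeff_apply (v w : H) (g : Γ) :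
    star (matrixCoeff π v w g) = matrixCoeff π w v g⁻¹ := by
  rw [matrixCoeff_apply, matrixCoeff_apply, ← star_rep, ContinuousLinearMap.star_eq_adjoint,
    ContinuousLinearMap.adjoint_inner_right]
  exact inner_conj_symm _ _

variable {ι : Type*} [Fintype ι] {V : Submodule ℂ H}

theorem matrixCoeff_mul_apply (b : OrthonormalBasis ι ℂ V)
    (hinv : ∀ (g : Γ), ∀ v ∈ V, (π g : H →L[ℂ] H) v ∈ V) (v : H) {w : H} (hw : w ∈ V) (g h : Γ) :
    matrixCoeff π v w (g * h) = ∑ k, matrixCoeff π v (b k) g * matrixCoeff π (b k) w h := by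
  have expand : (π h : H →L[ℂ] H) w = ∑ k, matrixCoeff π (b k) w h • (b k : H) := by
    have := congrArg (V.subtype) (b.sum_repr' ⟨(π h : H →L[ℂ] H) w, hinv h w hw⟩)
    rw [map_sum] at this
    exact this.symm
  rw [matrixCoeff_apply, map_mul, Submonoid.coe_mul, mul_apply_eq_comp, expand, map_sum, inner_sum]
  refine Finset.sum_congr rfl fun k _ => ?_
  rw [map_smul, inner_smul_right, mul_comm, matrixCoeff_apply v]

/-- Fell absorption: writing `M_f` for multiplication by `f` and `(bₖ)` for an orthonormal basis of
`V`, the multiplier is `x ↦ ∑ₖ M_f x M_f'` with `f = conj ⟪v, π(·) bₖ⟫` and `f' = ⟪w, π(·) bₖ⟫`. -/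
theorem exists_multiplier_matrixCoeff [FiniteDimensional ℂ V]
    (hinv : ∀ (g : Γ), ∀ v ∈ V, (π g : H →L[ℂ] H) v ∈ V) {v : H} (hv : v ∈ V) (w : H) :
    ∃ Z : ReducedCStar Γ →L[ℂ] ReducedCStar Γ,
      ∀ g, Z (regularOf Γ g) = matrixCoeff π w v g⁻¹ • regularOf Γ g := by
  let b := stdOrthonormalBasis ℂ V
  let Y : (ℓ²(Γ, ℂ) →L[ℂ] ℓ²(Γ, ℂ)) →L[ℂ] (ℓ²(Γ, ℂ) →L[ℂ] ℓ²(Γ, ℂ)) :=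
    ∑ k, ContinuousLinearMap.mulLeftRight ℂ (ℓ²(Γ, ℂ) →L[ℂ] ℓ²(Γ, ℂ))
      (mulOp (star (matrixCoeff π v (b k)))) (mulOp (matrixCoeff π w (b k)))
  refine exists_multiplier_groupCStar (Y := Y) fun g => ?_
  ext f h
  have Y_apply : Y (leftRegular Γ g) f h = ∑ k, star (matrixCoeff π v (b k) h) *
      (matrixCoeff π w (b k) (g⁻¹ * h) * f (g⁻¹ * h)) := by
    simp only [Y, sum_apply, lp.coeFn_sum, Finset.sum_apply]
    rfl
  have expand := matrixCoeff_mul_apply b hinv w hv (g⁻¹ * h) h⁻¹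
  rw [mul_inv_cancel_right] at expand
  change Y (leftRegular Γ g) f h = matrixCoeff π w v g⁻¹ * f (g⁻¹ * h)
  rw [Y_apply, expand, Finset.sum_mul]
  refine Finset.sum_congr rfl fun k _ => ?_
  rw [star_matrixCoeff_apply]
  ring

open scoped CStarAlgebra in
/-- Let `v` be a unit vector in `V`. For an orthonormal basis `(bₖ)` of `V`, the functional
`∑ₖ ⟪bₖ, π(g⁻¹) v⟫ ⟪v, π(g) bₖ⟫ = ⟪v, v⟫ = 1` is bounded on `C*_λ(Γ)`. -/
theorem isAmenable_of_finiteDimensional (ρ : ReducedCStar Γ →⋆ₐ[ℂ] (H →L[ℂ] H))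
    (V : Submodule ℂ H) [FiniteDimensional ℂ V] (hV : V ≠ ⊥)
    (hinv : ∀ (g : Γ), ∀ v ∈ V, (unitaryRep ρ g : H →L[ℂ] H) v ∈ V) : IsAmenable Γ := by
  have : Nontrivial V := Submodule.nontrivial_iff_ne_bot.2 hV
  obtain ⟨v, hv⟩ := exists_norm_eq V zero_le_one
  let b := stdOrthonormalBasis ℂ V
  choose Z hZ using fun k => exists_multiplier_matrixCoeff hinv v.2 (b k : H)
  let R : ReducedCStar Γ →L[ℂ] (H →L[ℂ] H) := ⟨ρ.toAlgHom.toLinearMap, map_continuous ρ⟩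
  let E : ReducedCStar Γ →L[ℂ] ℂ := ∑ k, (innerSL ℂ (v : H)).comp
    ((ContinuousLinearMap.apply ℂ H (b k : H)).comp (R.comp (Z k)))
  refine isAmenable_of_functional (E := E) fun g => ?_
  have E_apply : E (regularOf Γ g) =
      ∑ k, ⟪(v : H), ρ (Z k (regularOf Γ g)) (b k)⟫_ℂ := by
    simp only [E, sum_apply]
    rfl
  calc E (regularOf Γ g)
      = ∑ k, matrixCoeff (unitaryRep ρ) v (b k) g * matrixCoeff (unitaryRep ρ) (b k) v g⁻¹ := by
        rw [E_apply]
        refine Finset.sum_congr rfl fun k _ => ?_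
        rw [hZ, map_smul, smul_apply, inner_smul_right, mul_comm]
        rfl
    _ = matrixCoeff (unitaryRep ρ) v v (g * g⁻¹) := (matrixCoeff_mul_apply b hinv v v.2 _ _).symm
    _ = 1 := by
        rw [mul_inv_cancel, matrixCoeff_apply, map_one, OneMemClass.coe_one,
          one_apply_eq_self, inner_self_eq_norm_sq_to_K, ← Submodule.coe_norm, hv]
        simp

theorem IsNCJustInfinite.isAmenable_or_isCStarSimple (hΓ : IsNCJustInfinite Γ) :
    IsAmenable Γ ∨ IsCStarSimple Γ := by
  refine or_iff_not_imp_right.2 fun hsimple => ?_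
  simp only [IsCStarSimple, not_forall, not_or] at hsimple
  obtain ⟨I, -, hbot, htop⟩ := hsimple
  obtain ⟨b, hbI, hb⟩ : ∃ b ∈ I, b ≠ 0 := by
    contrapose! hbot
    exact le_bot_iff.1 fun x hx => (TwoSidedIdeal.mem_bot _).2 (hbot x hx)
  obtain ⟨H, _, _, _, _, ρ, hρ⟩ := exists_representation_of_ideal htop
  obtain ⟨V, _, hV, hinv⟩ := hΓ.exists_finiteDimensional ρ hb (hρ b hbI)
  exact isAmenable_of_finiteDimensional ρ V hV hinv

end FiniteDimensionalRepresentations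

section InvariantSubspaces

theorem starProjection_rep_apply {Γ : Type u} [Group Γ] {H : Type v} [NormedAddCommGroup H]
    [InnerProductSpace ℂ H] [CompleteSpace H] {π : Γ →* unitary (H →L[ℂ] H)} {V : Submodule ℂ H}
    [V.HasOrthogonalProjection] (hinv : ∀ (g : Γ), ∀ v ∈ V, (π g : H →L[ℂ] H) v ∈ V) (g : Γ)
    (x : H) : V.starProjection ((π g : H →L[ℂ] H) x) = (π g : H →L[ℂ] H) (V.starProjection x) := by
  refine Submodule.eq_starProjection_of_mem_orthogonal
    (hinv g _ (Submodule.starProjection_apply_mem _ _)) ?_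
  rw [← map_sub, Submodule.mem_orthogonal]
  intro v hv
  rw [← ContinuousLinearMap.adjoint_inner_left, ← ContinuousLinearMap.star_eq_adjoint, star_rep]
  exact (Submodule.mem_orthogonal _ _).1 (Submodule.sub_starProjection_mem_orthogonal x) _
    (hinv g⁻¹ v hv)

open Classical in
theorem summable_norm_starProjection_single_sq {ι : Type*} (V : Submodule ℂ ℓ²(ι, ℂ))
    [FiniteDimensional ℂ V] :
    Summable fun i => ‖V.starProjection (lp.single 2 i (1 : ℂ))‖ ^ 2 := by
  let b := stdOrthonormalBasis ℂ V
  have norm_sq_eq (i : ι) : ‖V.starProjection (lp.single 2 i (1 : ℂ))‖ ^ 2 =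
      ∑ k, ‖(b k : ℓ²(ι, ℂ)) i‖ ^ 2 := by
    rw [Submodule.starProjection_apply, Submodule.norm_coe, ← b.sum_sq_norm_inner_right]
    refine Finset.sum_congr rfl fun k _ => ?_
    rw [Submodule.inner_orthogonalProjectionOnto_eq_of_mem_left, lp.inner_single_right,
      RCLike.inner_apply, one_mul, RCLike.norm_conj]
  simp only [norm_sq_eq]
  refine summable_sum fun k _ => ?_
  simpa using (memℓp_gen_iff (by norm_num)).1 (lp.memℓp (b k : ℓ²(ι, ℂ)))

variable {Γ : Type u} [Group Γ]

open Classical in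
theorem leftRegular_single (g h : Γ) :
    (leftRegular Γ g : ℓ²(Γ, ℂ) →L[ℂ] ℓ²(Γ, ℂ)) (lp.single 2 h (1 : ℂ)) =
      lp.single 2 (g * h) (1 : ℂ) := by
  ext k
  simp only [leftRegular_apply, lp.single_apply, Pi.single_apply, inv_mul_eq_iff_eq_mul]

open Classical in
/-- The projection `P` onto `V` commutes with `λ`, so `‖P δ_h‖` does not depend on `h`; but
`∑ₕ ‖P δ_h‖² = dim V` is finite. -/
theorem eq_bot_of_finiteDimensional_of_invariant [Infinite Γ] (V : Submodule ℂ ℓ²(Γ, ℂ))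
    [FiniteDimensional ℂ V]
    (hinv : ∀ (g : Γ), ∀ v ∈ V, (leftRegular Γ g : ℓ²(Γ, ℂ) →L[ℂ] ℓ²(Γ, ℂ)) v ∈ V) : V = ⊥ := by
  have proj_single (h : Γ) : V.starProjection (lp.single 2 h (1 : ℂ)) =
      (leftRegular Γ h : ℓ²(Γ, ℂ) →L[ℂ] ℓ²(Γ, ℂ)) (V.starProjection (lp.single 2 1 (1 : ℂ))) := by
    rw [← starProjection_rep_apply hinv, leftRegular_single, mul_one]
  have norm_proj_single (h : Γ) : ‖V.starProjection (lp.single 2 h (1 : ℂ))‖ =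
      ‖V.starProjection (lp.single 2 (1 : Γ) (1 : ℂ))‖ := by
    rw [proj_single]
    exact Unitary.norm_map (leftRegular Γ h) _
  have hsum := summable_norm_starProjection_single_sq V
  simp only [norm_proj_single] at hsum
  have proj_one : V.starProjection (lp.single 2 (1 : Γ) (1 : ℂ)) = 0 := by
    simpa using (summable_const_iff _).1 hsum
  refine (Submodule.eq_bot_iff V).2 fun v hv => lp.ext (funext fun h => ?_)
  have hinner : ⟪lp.single 2 h (1 : ℂ), V.starProjection v⟫_ℂ = 0 := by
    rw [← Submodule.inner_starProjection_left_eq_right, proj_single, proj_one, map_zero,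
      inner_zero_left]
  rwa [Submodule.starProjection_eq_self_iff.2 hv, lp.inner_single_left, RCLike.inner_apply,
    map_one, mul_one] at hinner

end InvariantSubspaces

section ZeroDivisors

variable {H : Type v} [NormedAddCommGroup H] [InnerProductSpace ℂ H] [CompleteSpace H]

/-- The restriction of a star algebra of operators to an invariant closed subspace. -/
def restrictRep (S : StarSubalgebra ℂ (H →L[ℂ] H)) (K : Submodule ℂ H) [CompleteSpace K]
    (hK : ∀ x ∈ S, ∀ v ∈ K, x v ∈ K) : S →⋆ₐ[ℂ] (K →L[ℂ] K) where
  toFun x := (x : H →L[ℂ] H).restrict (hK x x.2)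
  map_one' := rfl
  map_mul' _ _ := rfl
  map_zero' := rfl
  map_add' _ _ := rfl
  commutes' _ := rfl
  map_star' x := by
    rw [ContinuousLinearMap.star_eq_adjoint, ContinuousLinearMap.eq_adjoint_iff]
    exact fun v w => ContinuousLinearMap.adjoint_inner_left (x : H →L[ℂ] H) _ _

theorem apply_eq_zero_of_nonneg_of_inner_eq_zero {b : H →L[ℂ] H} (hb : 0 ≤ b) {v : H}
    (hv : ⟪v, b v⟫_ℂ = 0) : b v = 0 := by
  obtain ⟨s, rfl⟩ := CStarAlgebra.nonneg_iff_eq_star_mul_self.1 hb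
  rw [mul_apply_eq_comp, ContinuousLinearMap.star_eq_adjoint,
    ContinuousLinearMap.adjoint_inner_right, inner_self_eq_zero] at hv
  rw [mul_apply_eq_comp, hv, map_zero]

/-- The witnesses are the negative and the positive part of `b`. -/
theorem exists_mul_eq_zero_of_isSelfAdjoint (S : StarSubalgebra ℂ (H →L[ℂ] H))
    [IsClosed (S : Set (H →L[ℂ] H))] {b : H →L[ℂ] H} (hbS : b ∈ S) (hb : IsSelfAdjoint b) {v : H}
    (hv : ⟪v, b v⟫_ℂ = 0) (hbv : b v ≠ 0) :
    ∃ c ∈ S, ∃ d : H →L[ℂ] H, (∀ y, Commute b y → Commute c y) ∧ c * d = 0 ∧ c ≠ 0 ∧ d ≠ 0 := by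
  have negPart_mem : b⁻ ∈ S := by
    rw [CFC.negPart_def]
    exact cfcₙ_mem (𝕜' := ℂ) _ hbS
  have commute_negPart {y : H →L[ℂ] H} (hy : Commute b y) : Commute b⁻ y := by
    rw [CFC.negPart_def]
    exact hy.cfcₙ_real _
  refine ⟨b⁻, negPart_mem, b⁺, fun _ => commute_negPart, CFC.negPart_mul_posPart b,
    fun h => hbv ?_, fun h => hbv (neg_eq_zero.1 ?_)⟩
  · exact apply_eq_zero_of_nonneg_of_inner_eq_zero ((CFC.negPart_eq_zero_iff b hb).1 h) hv
  · exact apply_eq_zero_of_nonneg_of_inner_eq_zero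
      (neg_nonneg.2 ((CFC.posPart_eq_zero_iff b hb).1 h)) (by simpa using hv)

variable {Γ : Type u} [Group Γ]

theorem commute_of_mem_groupCStar {π : Γ →* unitary (H →L[ℂ] H)} {c : H →L[ℂ] H}
    (hc : ∀ g, Commute c (π g : H →L[ℂ] H)) {x : H →L[ℂ] H} (hx : x ∈ groupCStar π) :
    Commute c x := by
  have h : (ContinuousLinearMap.mul ℂ (H →L[ℂ] H) c).comp (groupCStar π).toSubmodule.subtypeL =
      ((ContinuousLinearMap.mul ℂ (H →L[ℂ] H)).flip c).comp (groupCStar π).toSubmodule.subtypeL :=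
    groupCStar_clm_ext hc
  exact DFunLike.congr_fun h ⟨x, hx⟩

/-- If `c d = 0` with `d ≠ 0`, then `C*_λ(Γ)` acts on `ker c ≠ 0`, and this action kills `c`. -/
theorem IsNCJustInfinite.eq_zero_or_eq_zero_of_mul_eq_zero (hΓ : IsNCJustInfinite Γ)
    {c d : ℓ²(Γ, ℂ) →L[ℂ] ℓ²(Γ, ℂ)} (hc : c ∈ ReducedCStar Γ)
    (hcomm : ∀ g : Γ, Commute c (leftRegular Γ g)) (hcd : c * d = 0) : c = 0 ∨ d = 0 := by
  by_contra! ⟨hc0, hd0⟩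
  have := hΓ.1
  let K : Submodule ℂ ℓ²(Γ, ℂ) := LinearMap.ker c.toLinearMap
  have mem_K {v : ℓ²(Γ, ℂ)} : v ∈ K ↔ c v = 0 := Iff.rfl
  have : CompleteSpace K := (ContinuousLinearMap.isClosed_ker c).completeSpace_coe
  have K_invariant (x) (hx : x ∈ ReducedCStar Γ) (v) (hv : v ∈ K) : x v ∈ K := by
    rw [mem_K] at hv ⊢
    rw [← mul_apply_eq_comp, (commute_of_mem_groupCStar hcomm hx).eq, mul_apply_eq_comp, hv,
      map_zero]
  have : Nontrivial K := by
    obtain ⟨v, hv⟩ : ∃ v, d v ≠ 0 := by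
      contrapose! hd0
      exact ContinuousLinearMap.ext hd0
    exact nontrivial_of_ne ⟨d v, DFunLike.congr_fun hcd v⟩ 0 fun h => hv (congrArg Subtype.val h)
  let ρ := restrictRep (ReducedCStar Γ) K K_invariant
  have ρ_c : ρ ⟨c, hc⟩ = 0 := ContinuousLinearMap.ext fun v => Subtype.ext v.2
  obtain ⟨V, _, hV, hVinv⟩ := hΓ.exists_finiteDimensional ρ
    (b := ⟨c, hc⟩) (fun h => hc0 (congrArg Subtype.val h)) ρ_c
  have map_eq_bot : V.map K.subtype = ⊥ := by
    refine eq_bot_of_finiteDimensional_of_invariant _ ?_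
    rintro g _ ⟨v, hv, rfl⟩
    exact ⟨_, hVinv g v hv, rfl⟩
  exact hV (Submodule.map_injective_of_injective K.injective_subtype
    (map_eq_bot.trans (Submodule.map_bot _).symm))

end ZeroDivisors

section ICC

variable {Γ : Type u} [Group Γ]

/-- `∑ h ∈ C, (λ(h) + λ(h⁻¹))`; for a conjugacy class `C` this is a self-adjoint element of the
centre of `C*_λ(Γ)`. -/
def symmetricSum (C : Finset Γ) : ℓ²(Γ, ℂ) →L[ℂ] ℓ²(Γ, ℂ) :=
  ∑ h ∈ C, ((leftRegular Γ h : ℓ²(Γ, ℂ) →L[ℂ] ℓ²(Γ, ℂ)) + leftRegular Γ h⁻¹)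

variable (C : Finset Γ)

theorem isSelfAdjoint_symmetricSum : IsSelfAdjoint (symmetricSum C) := by
  refine isSelfAdjoint_sum C fun h _ => ?_
  rw [← star_rep]
  exact IsSelfAdjoint.add_star_self _

theorem symmetricSum_mem_reducedCStar : symmetricSum C ∈ ReducedCStar Γ :=
  sum_mem fun _ _ => add_mem (rep_mem_groupCStar _ _) (rep_mem_groupCStar _ _)

variable {C}

theorem commute_symmetricSum (hC : ∀ k, ∀ h ∈ C, k * h * k⁻¹ ∈ C) (k : Γ) :
    Commute (symmetricSum C) (leftRegular Γ k) := by
  rw [commute_iff_eq, symmetricSum, Finset.sum_mul, Finset.mul_sum]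
  refine Finset.sum_bij' (fun h _ => k⁻¹ * h * k) (fun h _ => k * h * k⁻¹)
    (fun h hh => by simpa using hC k⁻¹ h hh) (hC k) (fun h _ => by group) (fun h _ => by group)
    fun h _ => ?_
  simp only [add_mul, mul_add, ← Submonoid.coe_mul, ← map_mul]
  congr 3 <;> group

open Classical in
theorem symmetricSum_single_one_apply (y : Γ) :
    symmetricSum C (lp.single 2 1 (1 : ℂ)) y =
      (if y ∈ C then 1 else 0) + if y⁻¹ ∈ C then 1 else 0 := by
  have apply_single : symmetricSum C (lp.single 2 1 (1 : ℂ)) =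
      ∑ h ∈ C, (lp.single 2 h (1 : ℂ) + lp.single 2 h⁻¹ (1 : ℂ)) := by
    simp only [symmetricSum, sum_apply, add_apply, leftRegular_single, mul_one]
  rw [apply_single, lp.coeFn_sum, Finset.sum_apply]
  simp only [lp.coeFn_add, Pi.add_apply, lp.single_apply, Pi.single_apply, Finset.sum_add_distrib,
    ← inv_eq_iff_eq_inv, Finset.sum_ite_eq]

open Classical in
theorem IsNCJustInfinite.isICC (hΓ : IsNCJustInfinite Γ) : IsICC Γ := by
  intro g hg hinf
  have hfin : (conjugatesOf g).Finite := by simpa using hinf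
  let C : Finset Γ := hfin.toFinset
  have mem_C {x : Γ} : x ∈ C ↔ IsConj g x := hfin.mem_toFinset
  have one_notMem : (1 : Γ) ∉ C := fun h => hg (isConj_one_left.1 (mem_C.1 h))
  have conj_mem (k h : Γ) (hh : h ∈ C) : k * h * k⁻¹ ∈ C :=
    mem_C.2 ((mem_C.1 hh).trans (isConj_iff.2 ⟨k, rfl⟩))
  have inner_eq_zero :
      ⟪lp.single 2 1 (1 : ℂ), symmetricSum C (lp.single 2 1 (1 : ℂ))⟫_ℂ = 0 := by
    rw [lp.inner_single_left, symmetricSum_single_one_apply, inv_one, if_neg one_notMem, add_zero,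
      inner_zero_right]
  have apply_ne_zero : symmetricSum C (lp.single 2 1 (1 : ℂ)) ≠ 0 := fun h0 => by
    have h := symmetricSum_single_one_apply (C := C) g
    rw [h0, if_pos (mem_C.2 (IsConj.refl g)), lp.coeFn_zero, Pi.zero_apply] at h
    split_ifs at h <;> norm_num at h
  obtain ⟨c, hc, d, hcomm, hcd, hc0, hd0⟩ := exists_mul_eq_zero_of_isSelfAdjoint (ReducedCStar Γ)
    (symmetricSum_mem_reducedCStar C) (isSelfAdjoint_symmetricSum C) inner_eq_zero apply_ne_zero
  exact (hΓ.eq_zero_or_eq_zero_of_mul_eq_zero hc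
    (fun k => hcomm _ (commute_symmetricSum conj_mem k)) hcd).elim hc0 hd0

end ICC

section HalfSpaces

open scoped Pointwise commutatorElement

/-- The rigid stabilizer of `H`: the elements of `G` supported in `H`. -/
def rigidStabilizer (G : Type*) [Group G] {X : Type*} [MulAction G X] (H : Set X) : Subgroup G :=
  fixingSubgroup G Hᶜ

/-- A system of half-spaces for an action of `G` on `X`, abstracting the half-trees of a tree: a
`G`-invariant nested family of subsets closed under complements, on which the action is proximal
and micro-supported. -/
structure IsHalfSpaceSystem (G : Type*) [Group G] {X : Type*} [MulAction G X]
    (𝓗 : Set (Set X)) : Prop where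
  smul_mem : ∀ (g : G), ∀ H ∈ 𝓗, g • H ∈ 𝓗
  compl_mem : ∀ H ∈ 𝓗, Hᶜ ∈ 𝓗
  nested : ∀ H ∈ 𝓗, ∀ K ∈ 𝓗, H ⊆ K ∨ H ⊆ Kᶜ ∨ Hᶜ ⊆ K ∨ Hᶜ ⊆ Kᶜ
  exists_disjoint_smul : ∀ g : G, g ≠ 1 → ∃ H ∈ 𝓗, Disjoint (g • H) H
  exists_smul_subset : ∀ H ∈ 𝓗, ∀ K ∈ 𝓗, ∃ g : G, g • H ⊆ K
  exists_rigidStabilizer_ne_bot : ∃ H ∈ 𝓗, rigidStabilizer G H ≠ ⊥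

variable {G : Type*} [Group G] {X : Type*} [MulAction G X] {𝓗 : Set (Set X)} {H K : Set X}

theorem mem_rigidStabilizer_iff {a : G} : a ∈ rigidStabilizer G H ↔ ∀ x ∉ H, a • x = x :=
  mem_fixingSubgroup_iff G

theorem rigidStabilizer_mono (h : H ⊆ K) : rigidStabilizer G H ≤ rigidStabilizer G K :=
  fixingSubgroup_antitone G X (Set.compl_subset_compl.2 h)

theorem conj_mem_rigidStabilizer {a : G} (ha : a ∈ rigidStabilizer G H) (g : G) :
    g * a * g⁻¹ ∈ rigidStabilizer G (g • H) :=
  Set.conj_mem_fixingSubgroup Set.smul_set_compl ha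

theorem commute_of_mem_rigidStabilizer [FaithfulSMul G X] (h : Disjoint H K) {a b : G}
    (ha : a ∈ rigidStabilizer G H) (hb : b ∈ rigidStabilizer G K) : Commute a b := by
  have disjoint_toPerm : (MulAction.toPermHom G X a).Disjoint (MulAction.toPermHom G X b) := by
    intro x
    by_cases hx : x ∈ H
    · exact Or.inr (mem_rigidStabilizer_iff.1 hb x (Set.disjoint_left.1 h hx))
    · exact Or.inl (mem_rigidStabilizer_iff.1 ha x hx)
  refine MulAction.toPerm_injective (β := X) ?_
  change MulAction.toPermHom G X (a * b) = MulAction.toPermHom G X (b * a)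
  rw [map_mul, map_mul, disjoint_toPerm.commute.eq]

/-- `N` displaces `𝓗` if every half-space can be moved off itself by an element of `N`. -/
def Displaces (N : Subgroup G) (𝓗 : Set (Set X)) : Prop :=
  ∀ H ∈ 𝓗, ∃ n ∈ N, Disjoint (n • H) H

/-- `M` compresses `𝓗` if every half-space can be moved into every other one by an element
of `M`. -/
def Compresses (M : Subgroup G) (𝓗 : Set (Set X)) : Prop :=
  ∀ H ∈ 𝓗, ∀ K ∈ 𝓗, ∃ m ∈ M, m • H ⊆ K

/-- The commutators of pairs of elements of `M` supported in a common half-space. -/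
def rigidCommutators (M : Subgroup G) (𝓗 : Set (Set X)) : Set G :=
  {c | ∃ H ∈ 𝓗, ∃ a ∈ M ⊓ rigidStabilizer G H, ∃ b ∈ M ⊓ rigidStabilizer G H, ⁅a, b⁆ = c}

-- The double commutator trick: if `n ∈ N` moves `H` off itself, then `⁅a, b⁆ = ⁅⁅a, n⁆, b⁆`,
-- because `n a⁻¹ n⁻¹` is supported in `n • H` and so commutes with `b`.
theorem Displaces.rigidCommutators_subset [FaithfulSMul G X] {M N : Subgroup G}
    (hN : Displaces N 𝓗) (hMN : M ≤ Subgroup.normalizer (N : Set G)) :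
    rigidCommutators M 𝓗 ⊆ N := by
  rintro _ ⟨H, hH, a, ⟨haM, ha⟩, b, ⟨hbM, hb⟩, rfl⟩
  have conj_mem {m n : G} (hm : m ∈ M) (hn : n ∈ N) : m * n * m⁻¹ ∈ N :=
    (Subgroup.mem_normalizer_iff.1 (hMN hm) n).1 hn
  obtain ⟨n, hn, hdisj⟩ := hN H hH
  have commute_conj : Commute (n * a⁻¹ * n⁻¹) b :=
    commute_of_mem_rigidStabilizer hdisj (conj_mem_rigidStabilizer (inv_mem ha) n) hb
  have commutator_mem : a * n * a⁻¹ * n⁻¹ ∈ N := mul_mem (conj_mem haM hn) (inv_mem hn)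
  have commutator_eq : ⁅a, b⁆ = a * n * a⁻¹ * n⁻¹ * (b * (a * n * a⁻¹ * n⁻¹)⁻¹ * b⁻¹) :=
    calc ⁅a, b⁆ = a * (b * (n * a⁻¹ * n⁻¹)) * (n * a⁻¹ * n⁻¹)⁻¹ * a⁻¹ * b⁻¹ := by
          rw [commutatorElement_def]; group
      _ = _ := by rw [← commute_conj.eq]; group
  rw [commutator_eq]
  exact mul_mem commutator_mem (conj_mem hbM (inv_mem commutator_mem))

theorem conj_mem_rigidCommutators {M : Subgroup G} [M.Normal]
    (smul_mem : ∀ (g : G), ∀ H ∈ 𝓗, g • H ∈ 𝓗) (g : G) {c : G}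
    (hc : c ∈ rigidCommutators M 𝓗) : g * c * g⁻¹ ∈ rigidCommutators M 𝓗 := by
  obtain ⟨H, hH, a, ⟨haM, ha⟩, b, ⟨hbM, hb⟩, rfl⟩ := hc
  have hM : M.Normal := inferInstance
  exact ⟨g • H, smul_mem g H hH,
    g * a * g⁻¹, ⟨hM.conj_mem a haM g, conj_mem_rigidStabilizer ha g⟩,
    g * b * g⁻¹, ⟨hM.conj_mem b hbM g, conj_mem_rigidStabilizer hb g⟩,
    (conjugate_commutatorElement a b g).symm⟩

namespace IsHalfSpaceSystem

variable {M N : Subgroup G}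

theorem compresses_top (h𝓗 : IsHalfSpaceSystem G 𝓗) : Compresses (⊤ : Subgroup G) 𝓗 :=
  fun H hH K hK => (h𝓗.exists_smul_subset H hH K hK).imp fun _ hg => ⟨Subgroup.mem_top _, hg⟩

theorem displaces (h𝓗 : IsHalfSpaceSystem G 𝓗) (hM : Compresses M 𝓗) (hN : N ≠ ⊥)
    (hMN : M ≤ Subgroup.normalizer (N : Set G)) : Displaces N 𝓗 := by
  intro H hH
  obtain ⟨n, hn, hn1⟩ := N.bot_or_exists_ne_one.resolve_left hN
  obtain ⟨K, hK, hdisj⟩ := h𝓗.exists_disjoint_smul n hn1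
  obtain ⟨m, hm, hmH⟩ := hM H hH K hK
  refine ⟨m⁻¹ * n * m, (Subgroup.mem_normalizer_iff''.1 (hMN hm) n).1 hn, ?_⟩
  have smul_subset : (m⁻¹ * n * m) • H ⊆ m⁻¹ • n • K := by
    rw [mul_smul, mul_smul]
    exact Set.smul_set_mono (Set.smul_set_mono hmH)
  have subset_smul : H ⊆ m⁻¹ • K := by
    rwa [Set.subset_smul_set_iff, inv_inv]
  exact (Set.disjoint_smul_set.2 hdisj).mono smul_subset subset_smul

theorem compresses (h𝓗 : IsHalfSpaceSystem G 𝓗) (hM : Displaces M 𝓗) : Compresses M 𝓗 := by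
  intro H hH K hK
  obtain ⟨n, hn, hnH⟩ := hM H hH
  obtain ⟨k, hk, hkK⟩ := hM Kᶜ (h𝓗.compl_mem K hK)
  have smul_subset_compl : n • H ⊆ Hᶜ := hnH.subset_compl_right
  have smul_compl_subset : k • Kᶜ ⊆ K := Set.disjoint_compl_right_iff_subset.1 hkK
  rcases h𝓗.nested H hH K hK with h | h | h | h
  · exact ⟨1, one_mem _, by rwa [one_smul]⟩
  · exact ⟨k, hk, (Set.smul_set_mono h).trans smul_compl_subset⟩
  · exact ⟨n, hn, smul_subset_compl.trans h⟩
  · refine ⟨k * n, mul_mem hk hn, ?_⟩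
    rw [mul_smul]
    exact (Set.smul_set_mono (smul_subset_compl.trans h)).trans smul_compl_subset

theorem rigidStabilizer_ne_bot (h𝓗 : IsHalfSpaceSystem G 𝓗) (hK : K ∈ 𝓗) :
    rigidStabilizer G K ≠ ⊥ := by
  obtain ⟨H, hH, h⟩ := h𝓗.exists_rigidStabilizer_ne_bot
  obtain ⟨g, hg, hg1⟩ := (rigidStabilizer G H).bot_or_exists_ne_one.resolve_left h
  obtain ⟨k, hk⟩ := h𝓗.exists_smul_subset H hH K hK
  have conj_mem := rigidStabilizer_mono hk (conj_mem_rigidStabilizer hg k)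
  exact fun hbot => hg1 (conj_eq_one_iff.1 ((Subgroup.eq_bot_iff_forall _).1 hbot _ conj_mem))

-- If `a` is supported in `H` and moves `K` off itself, then `K ⊆ H`, and `a` cannot commute with
-- an element supported in `K`.
theorem exists_commutator_ne_one [FaithfulSMul G X] (h𝓗 : IsHalfSpaceSystem G 𝓗)
    (hM : ∀ H ∈ 𝓗, M ⊓ rigidStabilizer G H ≠ ⊥) (hH : H ∈ 𝓗) :
    ∃ a ∈ M ⊓ rigidStabilizer G H, ∃ b ∈ M ⊓ rigidStabilizer G H, ⁅a, b⁆ ≠ 1 := by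
  obtain ⟨a, ⟨haM, ha⟩, ha1⟩ := (Subgroup.bot_or_exists_ne_one _).resolve_left (hM H hH)
  obtain ⟨K, hK, hdisj⟩ := h𝓗.exists_disjoint_smul a ha1
  obtain ⟨b, ⟨hbM, hb⟩, hb1⟩ := (Subgroup.bot_or_exists_ne_one _).resolve_left (hM K hK)
  have subset : K ⊆ H := by
    intro x hx
    by_contra hxH
    have smul_eq : a • x = x := mem_rigidStabilizer_iff.1 ha x hxH
    exact Set.disjoint_left.1 hdisj (smul_eq ▸ Set.smul_mem_smul_set hx) hx
  refine ⟨a, ⟨haM, ha⟩, b, ⟨hbM, rigidStabilizer_mono subset hb⟩, fun h => hb1 ?_⟩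
  have conj_eq : a * b * a⁻¹ = b := mul_inv_eq_one.1 h
  have mem_smul : b ∈ rigidStabilizer G (a • K) := conj_eq ▸ conj_mem_rigidStabilizer hb a
  refine eq_of_smul_eq_smul (α := X) fun x => ?_
  rw [one_smul]
  by_cases hx : x ∈ K
  · exact mem_rigidStabilizer_iff.1 mem_smul x (Set.disjoint_right.1 hdisj hx)
  · exact mem_rigidStabilizer_iff.1 hb x hx

end IsHalfSpaceSystem

/-- The monolith of `G`: the intersection of all its nontrivial normal subgroups. -/
def monolith (G : Type*) [Group G] : Subgroup G :=
  sInf {N : Subgroup G | N.Normal ∧ N ≠ ⊥}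

theorem monolith_le {N : Subgroup G} (hN : N.Normal) (hN' : N ≠ ⊥) : monolith G ≤ N :=
  sInf_le ⟨hN, hN'⟩

instance monolith_normal : (monolith G).Normal where
  conj_mem m hm g := by
    rw [monolith, Subgroup.mem_sInf] at hm ⊢
    exact fun N hN => hN.1.conj_mem m (hm N hN) g

namespace IsHalfSpaceSystem

variable [FaithfulSMul G X]

theorem rigidCommutators_top_subset_monolith (h𝓗 : IsHalfSpaceSystem G 𝓗) :
    rigidCommutators (⊤ : Subgroup G) 𝓗 ⊆ monolith G := by
  intro c hc
  rw [monolith, SetLike.mem_coe, Subgroup.mem_sInf]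
  rintro N ⟨hN, hN'⟩
  have top_le : ⊤ ≤ Subgroup.normalizer (N : Set G) := (Subgroup.normalizer_eq_top N).ge
  exact (h𝓗.displaces h𝓗.compresses_top hN' top_le).rigidCommutators_subset top_le hc

theorem monolith_inf_rigidStabilizer_ne_bot (h𝓗 : IsHalfSpaceSystem G 𝓗) (hH : H ∈ 𝓗) :
    monolith G ⊓ rigidStabilizer G H ≠ ⊥ := by
  obtain ⟨a, ha, b, hb, hab⟩ := h𝓗.exists_commutator_ne_one (M := ⊤)
    (fun K hK => by simpa using h𝓗.rigidStabilizer_ne_bot hK) hH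
  have mem_monolith : ⁅a, b⁆ ∈ monolith G :=
    h𝓗.rigidCommutators_top_subset_monolith ⟨H, hH, a, ha, b, hb, rfl⟩
  have mem_rigidStabilizer : ⁅a, b⁆ ∈ rigidStabilizer G H :=
    mul_mem (mul_mem (mul_mem ha.2 hb.2) (inv_mem ha.2)) (inv_mem hb.2)
  exact fun h => hab ((Subgroup.eq_bot_iff_forall _).1 h _ ⟨mem_monolith, mem_rigidStabilizer⟩)

theorem exists_monolith_ne_one (h𝓗 : IsHalfSpaceSystem G 𝓗) (hH : H ∈ 𝓗) :
    ∃ a : monolith G, a ≠ 1 ∧ ∀ x ∉ H, a • x = x := by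
  obtain ⟨a, ⟨a_mem, a_fixes⟩, a_ne_one⟩ := (Subgroup.bot_or_exists_ne_one _).resolve_left
    (h𝓗.monolith_inf_rigidStabilizer_ne_bot hH)
  exact ⟨⟨a, a_mem⟩, fun h => a_ne_one (congrArg Subtype.val h), mem_rigidStabilizer_iff.1 a_fixes⟩

theorem monolith_ne_bot (h𝓗 : IsHalfSpaceSystem G 𝓗) : monolith G ≠ ⊥ := by
  obtain ⟨H, hH, -⟩ := h𝓗.exists_rigidStabilizer_ne_bot
  exact fun h => h𝓗.monolith_inf_rigidStabilizer_ne_bot hH (by rw [h, bot_inf_eq])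

theorem compresses_monolith (h𝓗 : IsHalfSpaceSystem G 𝓗) : Compresses (monolith G) 𝓗 :=
  h𝓗.compresses (h𝓗.displaces h𝓗.compresses_top h𝓗.monolith_ne_bot
    (Subgroup.normalizer_eq_top (monolith G)).ge)

theorem monolith_le_normalClosure_rigidCommutators (h𝓗 : IsHalfSpaceSystem G 𝓗) :
    monolith G ≤ Subgroup.normalClosure (rigidCommutators (monolith G) 𝓗) := by
  refine monolith_le Subgroup.normalClosure_normal fun hbot => ?_
  obtain ⟨H, hH, -⟩ := h𝓗.exists_rigidStabilizer_ne_bot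
  obtain ⟨a, ha, b, hb, hab⟩ := h𝓗.exists_commutator_ne_one
    (fun K hK => h𝓗.monolith_inf_rigidStabilizer_ne_bot hK) hH
  exact hab ((Subgroup.eq_bot_iff_forall _).1 hbot _
    (Subgroup.subset_normalClosure ⟨H, hH, a, ha, b, hb, rfl⟩))

theorem monolith_le_of_le_normalizer (h𝓗 : IsHalfSpaceSystem G 𝓗) {N : Subgroup G} (hN : N ≠ ⊥)
    (hMN : monolith G ≤ Subgroup.normalizer (N : Set G)) : monolith G ≤ N := by
  refine h𝓗.monolith_le_normalClosure_rigidCommutators.trans ((Subgroup.closure_le N).2 ?_)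
  intro c hc
  obtain ⟨s, hs, hsc⟩ := Group.mem_conjugatesOfSet_iff.1 hc
  obtain ⟨g, rfl⟩ := isConj_iff.1 hsc
  exact (h𝓗.displaces h𝓗.compresses_monolith hN hMN).rigidCommutators_subset hMN
    (conj_mem_rigidCommutators h𝓗.smul_mem g hs)

theorem isSimpleGroup_monolith (h𝓗 : IsHalfSpaceSystem G 𝓗) : IsSimpleGroup (monolith G) := by
  have hnt : Nontrivial (monolith G) := (Subgroup.nontrivial_iff_ne_bot _).2 h𝓗.monolith_ne_bot
  refine ⟨fun N hN => or_iff_not_imp_left.2 fun hbot => ?_⟩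
  have map_ne_bot : N.map (monolith G).subtype ≠ ⊥ := fun h =>
    hbot ((Subgroup.map_eq_bot_iff_of_injective N (monolith G).subtype_injective).1 h)
  have le_normalizer := Subgroup.le_normalizer_map (H := N) (monolith G).subtype
  rw [Subgroup.normalizer_eq_top N, ← MonoidHom.range_eq_map, Subgroup.range_subtype]
    at le_normalizer
  refine (Subgroup.eq_top_iff' N).2 fun m => ?_
  obtain ⟨n, hn, hnm⟩ := h𝓗.monolith_le_of_le_normalizer map_ne_bot le_normalizer m.2
  rwa [← Subtype.ext hnm]

end IsHalfSpaceSystem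

end HalfSpaces

section Amenability

open scoped Pointwise

variable {Γ : Type u} [Group Γ]

theorem isAmenable_of_finite [Finite Γ] : IsAmenable Γ := by
  have := Fintype.ofFinite Γ
  have card_ne_zero : (Fintype.card Γ : ℝ) ≠ 0 := Nat.cast_ne_zero.2 Fintype.card_ne_zero
  refine ⟨{ toFun f := (Fintype.card Γ : ℝ)⁻¹ * ∑ h, f h, map_add' f f' := ?_,
            map_smul' c f := ?_ }, ?_, fun f hf => ?_, fun g f f' hff => ?_⟩
  · simp only [lp.coeFn_add, Pi.add_apply, Finset.sum_add_distrib, mul_add]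
  · simp only [lp.coeFn_smul, Pi.smul_apply, smul_eq_mul, ← Finset.mul_sum, mul_left_comm,
      RingHom.id_apply]
  · simp [card_ne_zero]
  · exact mul_nonneg (by positivity) (Finset.sum_nonneg fun h _ => hf h)
  · change _ * ∑ h, f' h = _ * ∑ h, f h
    simp only [hff]
    congr 1
    exact Equiv.sum_comp (Equiv.mulLeft g⁻¹) f

/-- The indicator function of `S`, as a bounded function. -/
def boundedIndicator {α : Type*} (S : Set α) : ℓ^∞(α, ℝ) :=
  ⟨S.indicator 1, memℓp_infty ⟨1, by
    rintro _ ⟨x, rfl⟩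
    exact (norm_indicator_le_norm_self _ _).trans norm_one.le⟩⟩

theorem IsAmenable.exists_invariant_mean (hΓ : IsAmenable Γ) (X : Type*) [MulAction Γ X]
    [Nonempty X] : ∃ μ : Set X → ℝ, μ Set.univ = 1 ∧ (∀ S, 0 ≤ μ S) ∧
      (∀ S T, Disjoint S T → μ (S ∪ T) = μ S + μ T) ∧ ∀ (g : Γ) S, μ (g • S) = μ S := by
  obtain ⟨m, m_one, m_nonneg, m_invariant⟩ := hΓ
  obtain ⟨x₀⟩ := ‹Nonempty X›
  refine ⟨fun S => m (boundedIndicator {g | g • x₀ ∈ S}), (congrArg m ?_).trans m_one,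
    fun S => m_nonneg _ fun h => ?_, fun S T hST => (congrArg m ?_).trans (map_add m _ _),
    fun g S => m_invariant g _ _ fun h => ?_⟩
  · ext h
    simp [boundedIndicator]
  · exact Set.indicator_nonneg (fun _ _ => zero_le_one) h
  · ext h
    exact congrFun (Set.indicator_union_of_disjoint (hST.preimage (· • x₀)) 1) h
  · simp [boundedIndicator, Set.indicator, Set.mem_smul_set_iff_inv_smul_mem, smul_smul]

-- Under an invariant mean all members of `𝓗` have the same measure `t`, so that `2 t = 1`
-- and `3 t ≤ 1`.
theorem Compresses.not_isAmenable {X : Type*} [Nonempty X] [MulAction Γ X] {𝓗 : Set (Set X)}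
    {M : Subgroup Γ} (hM : Compresses M 𝓗) (hcompl : ∀ H ∈ 𝓗, Hᶜ ∈ 𝓗) {H₁ H₂ H₃ : Set X}
    (h₁ : H₁ ∈ 𝓗) (h₂ : H₂ ∈ 𝓗) (h₃ : H₃ ∈ 𝓗) (h₁₂ : Disjoint H₁ H₂) (h₁₃ : Disjoint H₁ H₃)
    (h₂₃ : Disjoint H₂ H₃) : ¬ IsAmenable M := by
  intro hamenable
  obtain ⟨μ, μ_univ, μ_nonneg, μ_union, μ_smul⟩ := hamenable.exists_invariant_mean X
  have μ_mono {S T : Set X} (hST : S ⊆ T) : μ S ≤ μ T := by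
    rw [← Set.union_sdiff_cancel hST, μ_union _ _ Set.disjoint_sdiff_right]
    exact le_add_of_nonneg_right (μ_nonneg _)
  have μ_le {H K : Set X} (hH : H ∈ 𝓗) (hK : K ∈ 𝓗) : μ H ≤ μ K := by
    obtain ⟨g, hg, hgH⟩ := hM H hH K hK
    exact (μ_smul ⟨g, hg⟩ H).ge.trans (μ_mono hgH)
  have two_mul : μ H₁ + μ H₁ᶜ = 1 := by
    rw [← μ_union _ _ disjoint_compl_right, Set.union_compl_self, μ_univ]
  have three_mul : μ H₁ + μ H₂ + μ H₃ ≤ 1 := by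
    rw [← μ_union _ _ h₁₂, ← μ_union _ _ (h₁₃.union_left h₂₃), ← μ_univ]
    exact μ_mono (Set.subset_univ _)
  linarith [μ_le (hcompl _ h₁) h₁, μ_le h₁ h₂, μ_le h₁ h₃]

end Amenability

section NotCStarSimple

open Filter Topology

section VanishingIdeal

section NormedSpace

variable {H : Type*} [NormedAddCommGroup H] [NormedSpace ℂ H] {η : ℕ → H}

/-- The bounded operators `x` with `x (η n) → 0`, for a sequence of vectors `η`. -/
def vanishingAlong (η : ℕ → H) : Submodule ℂ (H →L[ℂ] H) where
  carrier := {x | Tendsto (fun n => x (η n)) atTop (𝓝 0)}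
  zero_mem' := tendsto_const_nhds
  add_mem' {x y} hx hy := by simpa using Tendsto.add hx hy
  smul_mem' c x hx := by simpa using Tendsto.const_smul hx c

theorem mem_vanishingAlong {x : H →L[ℂ] H} :
    x ∈ vanishingAlong η ↔ Tendsto (fun n => x (η n)) atTop (𝓝 0) :=
  Iff.rfl

theorem mul_mem_vanishingAlong (x : H →L[ℂ] H) {y : H →L[ℂ] H} (hy : y ∈ vanishingAlong η) :
    x * y ∈ vanishingAlong η := by
  have tendsto_mul := (x.continuous.tendsto 0).comp (mem_vanishingAlong.1 hy)
  rwa [map_zero] at tendsto_mul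

theorem isClosed_vanishingAlong (hη : ∀ n, ‖η n‖ = 1) :
    IsClosed (vanishingAlong η : Set (H →L[ℂ] H)) := by
  refine isClosed_of_closure_subset fun x hx => ?_
  refine Metric.tendsto_atTop.2 fun ε hε => ?_
  obtain ⟨y, hy, hxy⟩ := Metric.mem_closure_iff.1 hx (ε / 2) (half_pos hε)
  obtain ⟨N, hN⟩ := Metric.tendsto_atTop.1 (mem_vanishingAlong.1 hy) (ε / 2) (half_pos hε)
  refine ⟨N, fun n hn => ?_⟩
  have dist_apply_lt : dist (x (η n)) (y (η n)) < ε / 2 := by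
    rw [dist_eq_norm] at hxy ⊢
    simpa [hη n] using ((x - y).le_opNorm (η n)).trans_lt (by simpa [hη n] using hxy)
  exact (dist_triangle _ _ _).trans_lt (by linarith [hN n hn])

end NormedSpace

variable {H : Type*} [NormedAddCommGroup H] [InnerProductSpace ℂ H] [CompleteSpace H] {η : ℕ → H}

/-- The largest two-sided ideal of `A` contained in the left ideal of operators vanishing along
`η`. -/
def vanishingIdeal (A : StarSubalgebra ℂ (H →L[ℂ] H)) (η : ℕ → H) : TwoSidedIdeal A :=
  TwoSidedIdeal.mk' {x | ∀ z : A, ((x * z : A) : H →L[ℂ] H) ∈ vanishingAlong η}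
    (fun z => by simp)
    (fun hx hy z => by simpa [add_mul] using add_mem (hx z) (hy z))
    (fun hx z => by simpa using hx z)
    (fun {x y} hy z => by simpa [mul_assoc] using mul_mem_vanishingAlong (x : H →L[ℂ] H) (hy z))
    (fun {x y} hx z => by simpa only [mul_assoc] using hx (y * z))

variable {A : StarSubalgebra ℂ (H →L[ℂ] H)}

theorem mem_vanishingIdeal {x : A} :
    x ∈ vanishingIdeal A η ↔ ∀ z : A, ((x * z : A) : H →L[ℂ] H) ∈ vanishingAlong η :=
  TwoSidedIdeal.mem_mk' ..

theorem isClosed_vanishingIdeal (hη : ∀ n, ‖η n‖ = 1) :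
    IsClosed (vanishingIdeal A η : Set A) := by
  have coe_eq : (vanishingIdeal A η : Set A) =
      ⋂ z : A, (fun x : A => ((x * z : A) : H →L[ℂ] H)) ⁻¹' vanishingAlong η := by
    ext x
    simp [mem_vanishingIdeal]
  rw [coe_eq]
  exact isClosed_iInter fun z => (isClosed_vanishingAlong hη).preimage
    (continuous_subtype_val.comp (continuous_id.mul continuous_const))

theorem vanishingIdeal_ne_top (hη : ∀ n, ‖η n‖ = 1) : vanishingIdeal A η ≠ ⊤ := by
  intro h
  have one_mem : (1 : A) ∈ vanishingIdeal A η := by rw [h]; trivial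
  have tendsto_η := mem_vanishingAlong.1 (mem_vanishingIdeal.1 one_mem 1)
  have tendsto_one : Tendsto (fun _ : ℕ => (1 : ℝ)) atTop (𝓝 0) := by
    simpa [hη] using tendsto_η.norm
  exact one_ne_zero (tendsto_nhds_unique tendsto_const_nhds tendsto_one)

end VanishingIdeal

variable {Γ : Type u} [Group Γ]

/-- The normalized indicator function of a finite subgroup, as a unit vector of `ℓ²(Γ)`. -/
def subgroupVector (L : Subgroup Γ) [Finite L] : ℓ²(Γ, ℂ) :=
  ⟨(L : Set Γ).indicator fun _ => ((√(Nat.card L) : ℝ) : ℂ)⁻¹,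
    (memℓp_zero ((Set.toFinite (L : Set Γ)).subset fun _ => Set.mem_of_indicator_ne_zero)
      ).of_exponent_ge zero_le⟩

theorem norm_subgroupVector (L : Subgroup Γ) [Finite L] : ‖subgroupVector L‖ = 1 := by
  have norm_sq_eq : ‖subgroupVector L‖ ^ 2 = 1 := by
    have norm_rpow_eq := lp.norm_rpow_eq_tsum (p := 2) (by norm_num) (subgroupVector L)
    have norm_apply_rpow (i : Γ) : ‖subgroupVector L i‖ ^ (2 : ℝ≥0∞).toReal =
        (L : Set Γ).indicator (fun _ => (Nat.card L : ℝ)⁻¹) i := by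
      by_cases hi : i ∈ L <;> simp [subgroupVector, hi]
    simp only [norm_apply_rpow, ← tsum_subtype, tsum_const] at norm_rpow_eq
    simpa using norm_rpow_eq
  exact (pow_eq_one_iff_of_nonneg (norm_nonneg _) two_ne_zero).1 norm_sq_eq

theorem leftRegular_subgroupVector (L : Subgroup Γ) [Finite L] {g : Γ} (hg : g ∈ L) :
    (leftRegular Γ g : ℓ²(Γ, ℂ) →L[ℂ] ℓ²(Γ, ℂ)) (subgroupVector L) = subgroupVector L := by
  ext h
  exact Set.indicator_const_eq_indicator_const (L.mul_mem_cancel_left (inv_mem hg))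

theorem one_sub_mul_one_sub_apply (a b h : Γ) (v : ℓ²(Γ, ℂ)) :
    (((1 - regularOf Γ a) * (1 - regularOf Γ b) * regularOf Γ h : ReducedCStar Γ) :
      ℓ²(Γ, ℂ) →L[ℂ] ℓ²(Γ, ℂ)) v =
      (leftRegular Γ h : ℓ²(Γ, ℂ) →L[ℂ] ℓ²(Γ, ℂ)) v -
        (leftRegular Γ (b * h) : ℓ²(Γ, ℂ) →L[ℂ] ℓ²(Γ, ℂ)) v -
        ((leftRegular Γ (a * h) : ℓ²(Γ, ℂ) →L[ℂ] ℓ²(Γ, ℂ)) v -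
          (leftRegular Γ (a * (b * h)) : ℓ²(Γ, ℂ) →L[ℂ] ℓ²(Γ, ℂ)) v) := by
  have expand : (1 - regularOf Γ a) * (1 - regularOf Γ b) * regularOf Γ h =
      regularOf Γ h - regularOf Γ (b * h) - (regularOf Γ (a * h) - regularOf Γ (a * (b * h))) := by
    simp only [regularOf, groupCStarOf_mul]
    noncomm_ring
  rw [expand]
  rfl

theorem one_sub_mul_one_sub_ne_zero {a b : Γ} (ha : a ≠ 1) (hb : b ≠ 1) :
    (1 - regularOf Γ a) * (1 - regularOf Γ b) ≠ 0 := by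
  classical
  intro hzero
  have apply_single := one_sub_mul_one_sub_apply a b 1 (lp.single 2 1 (1 : ℂ))
  rw [hzero, zero_mul] at apply_single
  have coeff_one := congrArg (fun v : ℓ²(Γ, ℂ) => (v 1).re) apply_single
  have coeff_nonneg : (0 : ℝ) ≤ (if 1 = a * b then (1 : ℂ) else 0).re := by
    split_ifs <;> simp
  have coeff_eq : (0 : ℝ) = 1 + (if 1 = a * b then (1 : ℂ) else 0).re := by
    simpa [leftRegular_single, Pi.single_apply, ha.symm, hb.symm] using coeff_one
  linarith

section FixedPoints

variable {X : Type*} [MulAction Γ X] {x₀ : X} {L : ℕ → Subgroup Γ} [∀ n, Finite (L n)]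

theorem eventually_leftRegular_mul_subgroupVector (hmono : Monotone L)
    (hstab : ∀ g : Γ, g • x₀ = x₀ → ∃ n, g ∈ L n) {g h : Γ} (hgh : g • h • x₀ = h • x₀) :
    ∀ᶠ n in atTop,
      (leftRegular Γ (g * h) : ℓ²(Γ, ℂ) →L[ℂ] ℓ²(Γ, ℂ)) (subgroupVector (L n)) =
        (leftRegular Γ h : ℓ²(Γ, ℂ) →L[ℂ] ℓ²(Γ, ℂ)) (subgroupVector (L n)) := by
  obtain ⟨N, hN⟩ := hstab (h⁻¹ * g * h) (by rw [mul_smul, mul_smul, hgh, inv_smul_smul])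
  filter_upwards [eventually_ge_atTop N] with n hn
  have mul_eq : g * h = h * (h⁻¹ * g * h) := by group
  rw [mul_eq, map_mul]
  exact congrArg (leftRegular Γ h : ℓ²(Γ, ℂ) →L[ℂ] ℓ²(Γ, ℂ))
    (leftRegular_subgroupVector (L n) (hmono hn hN))

theorem eventually_one_sub_mul_one_sub_apply_eq_zero (hmono : Monotone L)
    (hstab : ∀ g : Γ, g • x₀ = x₀ → ∃ n, g ∈ L n) {a b : Γ}
    (hab : ∀ x : X, a • x = x ∨ b • x = x) (h : Γ) :
    ∀ᶠ n in atTop,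
      (((1 - regularOf Γ a) * (1 - regularOf Γ b) * regularOf Γ h : ReducedCStar Γ) :
        ℓ²(Γ, ℂ) →L[ℂ] ℓ²(Γ, ℂ)) (subgroupVector (L n)) = 0 := by
  by_cases hbx : b • h • x₀ = h • x₀
  · filter_upwards [eventually_leftRegular_mul_subgroupVector hmono hstab hbx] with n hn
    have hn' : (leftRegular Γ (a * (b * h)) : ℓ²(Γ, ℂ) →L[ℂ] ℓ²(Γ, ℂ)) (subgroupVector (L n)) =
        (leftRegular Γ (a * h) : ℓ²(Γ, ℂ) →L[ℂ] ℓ²(Γ, ℂ)) (subgroupVector (L n)) := by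
      rw [map_mul _ a, map_mul _ a]
      exact congrArg (leftRegular Γ a : ℓ²(Γ, ℂ) →L[ℂ] ℓ²(Γ, ℂ)) hn
    rw [one_sub_mul_one_sub_apply, hn, hn', sub_self, sub_self, sub_self]
  · have hax : a • h • x₀ = h • x₀ := (hab _).resolve_right hbx
    have hax' : a • (b * h) • x₀ = (b * h) • x₀ := by
      refine (hab _).resolve_right fun hbb => hbx ?_
      rw [mul_smul] at hbb
      exact smul_left_cancel b hbb
    filter_upwards [eventually_leftRegular_mul_subgroupVector hmono hstab hax,
      eventually_leftRegular_mul_subgroupVector hmono hstab hax'] with n hn hn'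
    rw [one_sub_mul_one_sub_apply, hn, hn', sub_self]

theorem one_sub_mul_one_sub_mem_vanishingIdeal (hmono : Monotone L)
    (hstab : ∀ g : Γ, g • x₀ = x₀ → ∃ n, g ∈ L n) {a b : Γ}
    (hab : ∀ x : X, a • x = x ∨ b • x = x) :
    (1 - regularOf Γ a) * (1 - regularOf Γ b) ∈
      vanishingIdeal (ReducedCStar Γ) fun n => subgroupVector (L n) := by
  set w : ReducedCStar Γ := (1 - regularOf Γ a) * (1 - regularOf Γ b)
  refine mem_vanishingIdeal.2 fun z => ?_
  let V : Submodule ℂ (ReducedCStar Γ) :=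
    (vanishingAlong fun n => subgroupVector (L n)).comap
      ((ReducedCStar Γ).subtype.toLinearMap.comp (LinearMap.mulLeft ℂ w))
  have isClosed_V : IsClosed (V : Set (ReducedCStar Γ)) :=
    (isClosed_vanishingAlong fun n => norm_subgroupVector (L n)).preimage
      (continuous_subtype_val.comp (continuous_const.mul continuous_id))
  have span_le : Submodule.span ℂ (Set.range (regularOf Γ)) ≤ V := by
    rw [Submodule.span_le]
    rintro _ ⟨h, rfl⟩
    exact tendsto_nhds_of_eventually_eq
      (eventually_one_sub_mul_one_sub_apply_eq_zero hmono hstab hab h)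
  exact closure_minimal span_le isClosed_V (dense_span_groupCStarOf (leftRegular Γ) z)

-- The unit vectors `subgroupVector (L n)` are asymptotically fixed by the stabilizer of `x₀`, so
-- the ideal is the kernel of the representation on `ℓ²(Γ x₀)`, which is weakly contained in `λ_Γ`.
theorem not_isCStarSimple_of_locallyFinite_stabilizer (hmono : Monotone L)
    (hstab : ∀ g : Γ, g • x₀ = x₀ → ∃ n, g ∈ L n) {a b : Γ} (ha : a ≠ 1) (hb : b ≠ 1)
    (hab : ∀ x : X, a • x = x ∨ b • x = x) : ¬ IsCStarSimple Γ := by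
  intro hsimple
  have norm_eq_one (n : ℕ) := norm_subgroupVector (L n)
  have mem_ideal := one_sub_mul_one_sub_mem_vanishingIdeal hmono hstab hab
  rw [(hsimple _ (isClosed_vanishingIdeal norm_eq_one)).resolve_right
    (vanishingIdeal_ne_top norm_eq_one), TwoSidedIdeal.mem_bot] at mem_ideal
  exact one_sub_mul_one_sub_ne_zero ha hb mem_ideal

end FixedPoints

end NotCStarSimple

section FreeProducts

open Monoid Monoid.CoprodI

variable {ι : Type*} {M : ι → Type*} [∀ i, Group (M i)]

theorem exists_neWord_prod_eq {x : CoprodI M} (hx : x ≠ 1) :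
    ∃ (i j : ι) (w : NeWord M i j), w.prod = x := by
  classical
  have equiv_ne_empty : Word.equiv x ≠ Word.empty := by
    intro h
    apply hx
    rw [← Word.equiv.symm_apply_apply x, h]
    exact Word.prod_empty
  obtain ⟨i, j, w, hw⟩ := NeWord.of_word _ equiv_ne_empty
  refine ⟨i, j, w, ?_⟩
  rw [NeWord.prod, hw]
  exact Word.equiv.symm_apply_apply x

variable [DecidableEq ι] [∀ i, DecidableEq (M i)]

/-- The word in the index set recording the factors to which the successive letters of the reduced
word of `x` belong. It is the edge-label type of the path from `1` to `x` in the Bass-Serre tree. -/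
def indexWord (x : CoprodI M) : List ι := (Word.equiv x).toList.map Sigma.fst

theorem indexWord_prod (w : Word M) : indexWord w.prod = w.toList.map Sigma.fst := by
  rw [indexWord, show Word.equiv w.prod = w from Word.equiv.apply_symm_apply w]

theorem indexWord_neWord_prod {i j : ι} (w : NeWord M i j) :
    indexWord w.prod = w.toList.map Sigma.fst :=
  indexWord_prod w.toWord

@[simp]
theorem indexWord_one : indexWord (1 : CoprodI M) = [] := by
  rw [← Word.prod_empty, indexWord_prod]
  rfl

theorem head?_indexWord_neWord_prod {i j : ι} (w : NeWord M i j) :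
    (indexWord w.prod).head? = some i := by
  rw [indexWord_neWord_prod, List.head?_map, NeWord.toList_head?]
  rfl

theorem getLast?_indexWord_neWord_prod {i j : ι} (w : NeWord M i j) :
    (indexWord w.prod).getLast? = some j := by
  rw [indexWord_neWord_prod, List.getLast?_map, NeWord.toList_getLast?]
  rfl

theorem indexWord_eq_nil_iff {x : CoprodI M} : indexWord x = [] ↔ x = 1 := by
  refine ⟨fun h => ?_, fun h => h ▸ indexWord_one⟩
  by_contra hx
  obtain ⟨i, j, w, rfl⟩ := exists_neWord_prod_eq hx
  simpa [h] using head?_indexWord_neWord_prod w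

theorem indexWord_of {i : ι} {a : M i} (ha : a ≠ 1) : indexWord (CoprodI.of a) = [i] := by
  rw [← NeWord.prod_singleton a ha, indexWord_neWord_prod]
  rfl

theorem indexWord_mul {x y : CoprodI M}
    (h : ∀ i, (indexWord x).getLast? = some i → (indexWord y).head? ≠ some i) :
    indexWord (x * y) = indexWord x ++ indexWord y := by
  by_cases hx : x = 1
  · simp [hx]
  by_cases hy : y = 1
  · simp [hy]
  obtain ⟨i, j, w, rfl⟩ := exists_neWord_prod_eq hx
  obtain ⟨k, l, v, rfl⟩ := exists_neWord_prod_eq hy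
  have hjk : j ≠ k := by
    rintro rfl
    exact h j (getLast?_indexWord_neWord_prod w) (head?_indexWord_neWord_prod v)
  rw [← NeWord.append_prod (hne := hjk), indexWord_neWord_prod, indexWord_neWord_prod,
    indexWord_neWord_prod, ← List.map_append]
  rfl

theorem indexWord_inv (x : CoprodI M) : indexWord x⁻¹ = (indexWord x).reverse := by
  by_cases hx : x = 1
  · simp [hx]
  obtain ⟨i, j, w, rfl⟩ := exists_neWord_prod_eq hx
  rw [← NeWord.inv_prod, indexWord_neWord_prod, indexWord_neWord_prod]
  clear hx
  induction w with
  | singleton a ha => rfl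
  | append w₁ h w₂ ih₁ ih₂ =>
    simp only [NeWord.inv, NeWord.toList, List.map_append, List.reverse_append, ih₁, ih₂]

theorem head?_indexWord_mul {x y : CoprodI M} (hx : x ≠ 1)
    (h : (indexWord x).getLast? ≠ (indexWord y).head?) :
    (indexWord (x * y)).head? = (indexWord x).head? := by
  rw [indexWord_mul fun i hi hi' => h (hi.trans hi'.symm), List.head?_append_of_ne_nil]
  rwa [Ne, indexWord_eq_nil_iff]

theorem indexWord_mul_of {y : CoprodI M} {i : ι} {s : M i} (hs : s ≠ 1)
    (hy : (indexWord y).getLast? ≠ some i) :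
    indexWord (y * CoprodI.of s) = indexWord y ++ [i] := by
  rw [indexWord_mul, indexWord_of hs]
  intro k hk
  rw [indexWord_of hs, List.head?_singleton]
  rintro ⟨⟩
  exact hy hk

/-- The `M i`-component of the first letter of `x` (`1` if `x` does not start in `M i`). -/
def firstLetter (i : ι) (x : CoprodI M) : M i := (Word.equivPair i (Word.equiv x)).head

theorem exists_eq_firstLetter_mul (i : ι) (x : CoprodI M) :
    ∃ u : CoprodI M, (indexWord u).head? ≠ some i ∧ x = CoprodI.of (firstLetter i x) * u := by
  set p := Word.equivPair i (Word.equiv x) with hp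
  refine ⟨p.tail.prod, ?_, ?_⟩
  · rw [indexWord_prod, List.head?_map]
    exact p.fstIdx_ne
  · have rcons_p : Word.rcons p = Word.equiv x := by
      rw [← Word.equivPair_symm, hp, Equiv.symm_apply_apply]
    rw [firstLetter, ← hp, ← Word.prod_rcons, rcons_p]
    exact (Word.equiv.symm_apply_apply x).symm

theorem firstLetter_of_mul (i : ι) (a : M i) {u : CoprodI M}
    (hu : (indexWord u).head? ≠ some i) : firstLetter i (CoprodI.of a * u) = a := by
  have fstIdx_ne : (Word.equiv u).fstIdx ≠ some i := by
    rwa [indexWord, List.head?_map] at hu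
  let p : Word.Pair M i := ⟨a, Word.equiv u, fstIdx_ne⟩
  have prod_rcons_p : (Word.rcons p).prod = CoprodI.of a * u := by
    rw [Word.prod_rcons, show p.tail.prod = u from Word.equiv.symm_apply_apply u]
  rw [firstLetter, ← prod_rcons_p, show Word.equiv (Word.rcons p).prod = Word.rcons p from
    Word.equiv.apply_symm_apply _, ← Word.equivPair_symm, Equiv.apply_symm_apply]

theorem exists_eq_mul_of {x : CoprodI M} (hx : x ≠ 1) :
    ∃ (y : CoprodI M) (i : ι) (s : M i), x = y * CoprodI.of s ∧ s ≠ 1 ∧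
      (indexWord y).getLast? ≠ some i := by
  obtain ⟨i, j, w, hw⟩ := exists_neWord_prod_eq (inv_ne_one.2 hx)
  have head?_inv : (indexWord x⁻¹).head? = some i := hw ▸ head?_indexWord_neWord_prod w
  obtain ⟨u, hu, hxu⟩ := exists_eq_firstLetter_mul i x⁻¹
  have firstLetter_ne_one : firstLetter i x⁻¹ ≠ 1 := by
    intro h
    rw [h, map_one, one_mul] at hxu
    exact hu (hxu ▸ head?_inv)
  refine ⟨u⁻¹, i, (firstLetter i x⁻¹)⁻¹, ?_, inv_ne_one.2 firstLetter_ne_one, ?_⟩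
  · rw [map_inv, ← mul_inv_rev, ← hxu, inv_inv]
  · rwa [indexWord_inv, List.getLast?_reverse]

theorem head?_indexWord_mul_of {y : CoprodI M} {i : ι} (hy : y ≠ 1)
    (h : (indexWord y).getLast? ≠ some i) (s : M i) :
    (indexWord (y * CoprodI.of s)).head? = (indexWord y).head? := by
  by_cases hs : s = 1
  · rw [hs, map_one, mul_one]
  · rw [indexWord_mul_of hs h, List.head?_append_of_ne_nil]
    rwa [Ne, indexWord_eq_nil_iff]

theorem head?_indexWord_mul_of_ne_some {t : CoprodI M} {i : ι} (ht : t ≠ 1)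
    (h : (indexWord t).head? ≠ some i) (j : ι) (s : M j) :
    (indexWord (t * CoprodI.of s)).head? ≠ some i := by
  obtain ⟨y, k, c, rfl, hc, hy⟩ := exists_eq_mul_of ht
  by_cases hkj : k = j
  · subst hkj
    rw [mul_assoc, ← map_mul]
    by_cases y_one : y = 1
    · rw [y_one, one_mul] at h ⊢
      by_cases hcs : c * s = 1
      · simp [hcs]
      · rwa [indexWord_of hcs, ← indexWord_of hc]
    · rwa [head?_indexWord_mul_of y_one hy] at h ⊢
  · rwa [head?_indexWord_mul_of ht]
    rw [indexWord_mul_of hc hy, List.getLast?_append]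
    simpa using hkj

theorem finite_setOf_length_indexWord_le [Finite ι] [∀ i, Finite (M i)] (n : ℕ) :
    {x : CoprodI M | (indexWord x).length ≤ n}.Finite := by
  induction n with
  | zero =>
    refine (Set.finite_singleton (1 : CoprodI M)).subset fun x hx => ?_
    exact indexWord_eq_nil_iff.1 (List.length_eq_zero_iff.1 (Nat.le_zero.1 hx))
  | succ n ih =>
    refine ((Set.finite_singleton (1 : CoprodI M)).union
      (ih.image2 (fun y (p : Σ i, M i) => y * CoprodI.of p.2) Set.finite_univ)).subset
        fun x hx => ?_
    by_cases x_one : x = 1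
    · exact Or.inl x_one
    · obtain ⟨y, i, s, rfl, hs, hy⟩ := exists_eq_mul_of x_one
      refine Or.inr ⟨y, ?_, ⟨i, s⟩, Set.mem_univ _, rfl⟩
      rw [Set.mem_ofPred_eq, indexWord_mul_of hs hy, List.length_append] at hx
      exact Nat.le_of_succ_le_succ hx

end FreeProducts

section TreeGroup

open Monoid Monoid.CoprodI
open scoped Pointwise

variable {ι : Type*} [DecidableEq ι] {M : ι → Type*} [∀ i, Group (M i)] [∀ i, DecidableEq (M i)]

/-- The group of permutations of a free product that preserve the index word of `x⁻¹ * y` and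
commute with right multiplication by each letter up to finitely many exceptions. These are the
label-preserving automorphisms of the Bass-Serre tree that act by translations at almost every
vertex; encoding them on the free product avoids building the tree. -/
def treeGroup (M : ι → Type*) [∀ i, Group (M i)] [∀ i, DecidableEq (M i)] :
    Subgroup (Equiv.Perm (CoprodI M)) where
  carrier := {g | (∀ x y, indexWord ((g x)⁻¹ * g y) = indexWord (x⁻¹ * y)) ∧
    ∀ i (s : M i), {x | g (x * CoprodI.of s) ≠ g x * CoprodI.of s}.Finite}
  one_mem' := ⟨fun _ _ => rfl, fun _ _ => by simp⟩
  mul_mem' := by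
    rintro g h ⟨hg, g_finite⟩ ⟨hh, h_finite⟩
    refine ⟨fun x y => (hg _ _).trans (hh _ _), fun i s =>
      ((h_finite i s).union ((g_finite i s).preimage h.injective.injOn)).subset fun x hx => ?_⟩
    by_contra hx'
    simp only [Set.mem_union, Set.mem_ofPred_eq, Set.mem_preimage, not_or, not_not] at hx'
    exact hx (by rw [Equiv.Perm.mul_apply, Equiv.Perm.mul_apply, hx'.1, hx'.2])
  inv_mem' := by
    rintro g ⟨hg, g_finite⟩
    refine ⟨fun x y => ?_, fun i s => ((g_finite i s).image g).subset fun x hx => ?_⟩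
    · rw [← hg, Equiv.Perm.coe_inv, g.apply_symm_apply, g.apply_symm_apply]
    · refine ⟨g⁻¹ x, fun h => hx ?_, g.apply_symm_apply x⟩
      rw [Equiv.Perm.inv_eq_iff_eq, h, Equiv.Perm.coe_inv, g.apply_symm_apply]

theorem mulLeft_mem_treeGroup (d : CoprodI M) : Equiv.mulLeft d ∈ treeGroup M := by
  refine ⟨fun x y => ?_, fun i s => ?_⟩
  · congr 1
    simp [mul_assoc]
  · simp [mul_assoc]

theorem treeGroup_smul_def (g : treeGroup M) (x : CoprodI M) :
    g • x = (g : Equiv.Perm (CoprodI M)) x := rfl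

theorem indexWord_inv_smul_mul_smul (g : treeGroup M) (x y : CoprodI M) :
    indexWord ((g • x)⁻¹ * g • y) = indexWord (x⁻¹ * y) := g.2.1 x y

theorem head?_indexWord_inv_mul {x y z : CoprodI M} (hxy : x ≠ y)
    (h : (indexWord (x⁻¹ * y)).getLast? ≠ (indexWord (y⁻¹ * z)).head?) :
    (indexWord (x⁻¹ * z)).head? = (indexWord (x⁻¹ * y)).head? := by
  rw [← head?_indexWord_mul _ h]
  · congr 2
    group
  · rwa [Ne, inv_mul_eq_one]

/-- The half-tree at `x` in the direction `i`: the `y` for which the reduced word of `x⁻¹ * y`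
starts in `M i`. -/
def branch (i : ι) (x : CoprodI M) : Set (CoprodI M) :=
  {y | (indexWord (x⁻¹ * y)).head? = some i}

theorem mem_branch {i : ι} {x y : CoprodI M} :
    y ∈ branch i x ↔ (indexWord (x⁻¹ * y)).head? = some i := Iff.rfl

theorem smul_branch (g : treeGroup M) (i : ι) (x : CoprodI M) :
    g • branch i x = branch i (g • x) := by
  ext y
  rw [Set.mem_smul_set_iff_inv_smul_mem, mem_branch, mem_branch,
    ← indexWord_inv_smul_mul_smul g, smul_inv_smul]

theorem disjoint_branch {i j : ι} (hij : i ≠ j) (x : CoprodI M) :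
    Disjoint (branch i x) (branch j x) :=
  Set.disjoint_left.2 fun _ hi hj => hij (Option.some.inj (hi.symm.trans hj))

theorem mem_branch_iff_of_getLast?_ne {i : ι} {x y z : CoprodI M} (hxy : x ≠ y)
    (h : (indexWord (x⁻¹ * y)).getLast? ≠ (indexWord (y⁻¹ * z)).head?) :
    z ∈ branch i x ↔ y ∈ branch i x := by
  rw [mem_branch, head?_indexWord_inv_mul hxy h, mem_branch]

theorem branch_nested (i j : ι) (x y : CoprodI M) :
    branch i x ⊆ branch j y ∨ branch i x ⊆ (branch j y)ᶜ ∨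
      (branch i x)ᶜ ⊆ branch j y ∨ (branch i x)ᶜ ⊆ (branch j y)ᶜ := by
  by_cases hxy : x = y
  · subst hxy
    by_cases hij : i = j
    · exact Or.inl (hij ▸ subset_rfl)
    · exact Or.inr (Or.inl (disjoint_branch hij x).subset_compl_right)
  by_cases x_mem : (indexWord (x⁻¹ * y)).getLast? = some j
  · have key {z} (hz : z ∉ branch j y) : z ∈ branch i x ↔ y ∈ branch i x :=
      mem_branch_iff_of_getLast?_ne hxy fun h => hz (h.symm.trans x_mem)
    by_cases y_mem : y ∈ branch i x
    · exact Or.inr (Or.inr (Or.inl fun z hzx => by_contra fun hzy => hzx ((key hzy).2 y_mem)))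
    · exact Or.inl fun z hzx => by_contra fun hzy => y_mem ((key hzy).1 hzx)
  · have key {z} (hz : z ∈ branch j y) : z ∈ branch i x ↔ y ∈ branch i x :=
      mem_branch_iff_of_getLast?_ne hxy fun h => x_mem (h.trans hz)
    by_cases y_mem : y ∈ branch i x
    · exact Or.inr (Or.inr (Or.inr fun z hzx hzy => hzx ((key hzy).2 y_mem)))
    · exact Or.inr (Or.inl fun z hzx hzy => y_mem ((key hzy).1 hzx))

theorem compl_branch_subset {i : ι} {s : M i} (hs : s ≠ 1) (x : CoprodI M) :
    (branch i x)ᶜ ⊆ branch i (x * CoprodI.of s) := by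
  intro z hz
  have indexWord_of_inv := indexWord_of (inv_ne_one.2 hs)
  rw [mem_branch, mul_inv_rev, ← map_inv, mul_assoc, head?_indexWord_mul, indexWord_of_inv]
  · rfl
  · rw [Ne, ← indexWord_eq_nil_iff, indexWord_of_inv]
    exact List.cons_ne_nil _ _
  · rw [indexWord_of_inv]
    exact fun h => hz h.symm

theorem head?_indexWord_of_mem_branch_mul {l : ι} {v y z : CoprodI M} (hv : v ≠ 1)
    (hvl : (indexWord v).getLast? ≠ some l) (hz : z ∈ branch l (y * v)) :
    (indexWord (y⁻¹ * z)).head? = (indexWord v).head? := by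
  have head?_eq := head?_indexWord_inv_mul (x := y) (y := y * v) (z := z) (by simpa using hv)
  rw [inv_mul_cancel_left, mem_branch.1 hz] at head?_eq
  exact head?_eq hvl

variable (M) in
/-- The half-trees of the Bass-Serre tree: the sets `branch i x` and their complements. -/
def halfSpaces : Set (Set (CoprodI M)) := {S | ∃ i x, S = branch i x ∨ S = (branch i x)ᶜ}

theorem branch_mem_halfSpaces (i : ι) (x : CoprodI M) : branch i x ∈ halfSpaces M :=
  ⟨i, x, Or.inl rfl⟩

theorem compl_mem_halfSpaces {H : Set (CoprodI M)} (hH : H ∈ halfSpaces M) :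
    Hᶜ ∈ halfSpaces M := by
  obtain ⟨i, x, rfl | rfl⟩ := hH
  · exact ⟨i, x, Or.inr rfl⟩
  · exact ⟨i, x, Or.inl (compl_compl _)⟩

theorem smul_mem_halfSpaces (g : treeGroup M) {H : Set (CoprodI M)} (hH : H ∈ halfSpaces M) :
    g • H ∈ halfSpaces M := by
  obtain ⟨i, x, rfl | rfl⟩ := hH
  · exact ⟨i, g • x, Or.inl (smul_branch g i x)⟩
  · exact ⟨i, g • x, Or.inr (by rw [Set.smul_set_compl, smul_branch])⟩

theorem halfSpaces_nested {H K : Set (CoprodI M)} (hH : H ∈ halfSpaces M)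
    (hK : K ∈ halfSpaces M) : H ⊆ K ∨ H ⊆ Kᶜ ∨ Hᶜ ⊆ K ∨ Hᶜ ⊆ Kᶜ := by
  obtain ⟨i, x, rfl | rfl⟩ := hH <;> obtain ⟨j, y, rfl | rfl⟩ := hK <;>
    rcases branch_nested i j x y with h | h | h | h <;> simp [h]

theorem exists_subset_branch [∀ i, Nontrivial (M i)] {H : Set (CoprodI M)}
    (hH : H ∈ halfSpaces M) : ∃ i x, H ⊆ branch i x := by
  obtain ⟨i, x, rfl | rfl⟩ := hH
  · exact ⟨i, x, subset_rfl⟩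
  · obtain ⟨s, hs⟩ := exists_ne (1 : M i)
    exact ⟨i, _, compl_branch_subset hs x⟩

theorem exists_branch_subset [∀ i, Nontrivial (M i)] (hι : ∀ i j : ι, ∃ k, k ≠ i ∧ k ≠ j)
    {K : Set (CoprodI M)} (hK : K ∈ halfSpaces M) (l : ι) : ∃ z, branch l z ⊆ K := by
  obtain ⟨j, y, hK⟩ := hK
  obtain ⟨m, hmj, hml⟩ := hι j l
  obtain ⟨r, hr⟩ := exists_ne (1 : M m)
  obtain ⟨s, hs⟩ := exists_ne (1 : M j)
  rcases hK with rfl | rfl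
  · have indexWord_sr : indexWord (CoprodI.of s * CoprodI.of r) = [j, m] := by
      rw [indexWord_mul_of hr, indexWord_of hs]
      · rfl
      · simpa [indexWord_of hs] using hmj.symm
    have sr_ne_one : CoprodI.of s * CoprodI.of r ≠ (1 : CoprodI M) := by
      simp [← indexWord_eq_nil_iff, indexWord_sr]
    refine ⟨y * (CoprodI.of s * CoprodI.of r), fun w hw => ?_⟩
    rw [mem_branch, head?_indexWord_of_mem_branch_mul sr_ne_one (by simpa [indexWord_sr]) hw,
      indexWord_sr]
    rfl
  · have r_ne_one : CoprodI.of r ≠ (1 : CoprodI M) := by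
      simp [← indexWord_eq_nil_iff, indexWord_of hr]
    refine ⟨y * CoprodI.of r, fun w hw hw' => hmj ?_⟩
    rw [mem_branch, head?_indexWord_of_mem_branch_mul r_ne_one (by simpa [indexWord_of hr]) hw,
      indexWord_of hr] at hw'
    exact Option.some.inj hw'

theorem exists_smul_halfSpace_subset [∀ i, Nontrivial (M i)]
    (hι : ∀ i j : ι, ∃ k, k ≠ i ∧ k ≠ j) {H K : Set (CoprodI M)} (hH : H ∈ halfSpaces M)
    (hK : K ∈ halfSpaces M) : ∃ g : treeGroup M, g • H ⊆ K := by
  obtain ⟨i, x, H_subset⟩ := exists_subset_branch hH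
  obtain ⟨z, branch_subset⟩ := exists_branch_subset hι hK i
  refine ⟨⟨Equiv.mulLeft (z * x⁻¹), mulLeft_mem_treeGroup _⟩,
    (Set.smul_set_mono H_subset).trans ?_⟩
  rw [smul_branch, treeGroup_smul_def]
  simpa using branch_subset

-- If `g` moves `x`, then any branch at `x` on neither end of the path from `x` to `g • x` works.
theorem exists_disjoint_smul_halfSpace (hι : ∀ i j : ι, ∃ k, k ≠ i ∧ k ≠ j) {g : treeGroup M}
    (hg : g ≠ 1) : ∃ H ∈ halfSpaces M, Disjoint (g • H) H := by
  obtain ⟨x, hx⟩ : ∃ x : CoprodI M, x ≠ g • x := by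
    by_contra! h
    exact hg (Subtype.ext (Equiv.ext fun x => (h x).symm))
  obtain ⟨i, j, w, hw⟩ := exists_neWord_prod_eq (inv_mul_eq_one.not.2 hx)
  obtain ⟨k, hki, hkj⟩ := hι i j
  refine ⟨branch k x, branch_mem_halfSpaces k x, Set.disjoint_left.2 fun z hz hz' => hki ?_⟩
  rw [smul_branch, mem_branch] at hz
  rw [mem_branch, head?_indexWord_inv_mul hx, ← hw, head?_indexWord_neWord_prod] at hz'
  · exact (Option.some.inj hz').symm
  · rw [← hw, getLast?_indexWord_neWord_prod, hz]
    simpa using hkj.symm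

/-- The map applying `τ` to the `M i`-component of the first letter. -/
def twist (i : ι) (τ : Equiv.Perm (M i)) (x : CoprodI M) : CoprodI M :=
  CoprodI.of (τ (firstLetter i x)) * (CoprodI.of (firstLetter i x))⁻¹ * x

theorem twist_of_mul {i : ι} (τ : Equiv.Perm (M i)) (a : M i) {u : CoprodI M}
    (hu : (indexWord u).head? ≠ some i) :
    twist i τ (CoprodI.of a * u) = CoprodI.of (τ a) * u := by
  rw [twist, firstLetter_of_mul i a hu, mul_assoc, inv_mul_cancel_left]

theorem twist_twist {i : ι} (σ τ : Equiv.Perm (M i)) (x : CoprodI M) :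
    twist i σ (twist i τ x) = twist i (σ * τ) x := by
  obtain ⟨u, hu, hx⟩ := exists_eq_firstLetter_mul i x
  rw [hx, twist_of_mul τ _ hu, twist_of_mul σ _ hu, twist_of_mul _ _ hu, Equiv.Perm.mul_apply]

theorem twist_one (i : ι) (x : CoprodI M) : twist i 1 x = x := by
  rw [twist, Equiv.Perm.one_apply, mul_inv_cancel, one_mul]

/-- The map `twist i τ` as a permutation. For `τ` fixing `1` it is a tree automorphism supported
on the branch at `1` in the direction `i`. -/
def twistPerm (i : ι) (τ : Equiv.Perm (M i)) : Equiv.Perm (CoprodI M) where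
  toFun := twist i τ
  invFun := twist i τ⁻¹
  left_inv x := by rw [twist_twist, inv_mul_cancel, twist_one]
  right_inv x := by rw [twist_twist, mul_inv_cancel, twist_one]

theorem twistPerm_apply (i : ι) (τ : Equiv.Perm (M i)) (x : CoprodI M) :
    twistPerm i τ x = twist i τ x := rfl

theorem indexWord_inv_mul_of_mul {i : ι} {c : M i} (hc : c ≠ 1) {u v : CoprodI M}
    (hu : (indexWord u).head? ≠ some i) (hv : (indexWord v).head? ≠ some i) :
    indexWord (u⁻¹ * CoprodI.of c * v) = (indexWord u).reverse ++ [i] ++ indexWord v := by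
  have indexWord_inv_mul_of : indexWord (u⁻¹ * CoprodI.of c) = (indexWord u).reverse ++ [i] := by
    rw [indexWord_mul_of hc, indexWord_inv]
    rwa [indexWord_inv, List.getLast?_reverse]
  rw [indexWord_mul, indexWord_inv_mul_of]
  intro k hk
  rw [indexWord_inv_mul_of, List.getLast?_append] at hk
  obtain rfl : i = k := by simpa using hk
  exact hv

theorem indexWord_inv_twist_mul_twist (i : ι) (τ : Equiv.Perm (M i)) (x y : CoprodI M) :
    indexWord ((twist i τ x)⁻¹ * twist i τ y) = indexWord (x⁻¹ * y) := by
  obtain ⟨u, hu, hx⟩ := exists_eq_firstLetter_mul i x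
  obtain ⟨v, hv, hy⟩ := exists_eq_firstLetter_mul i y
  have merge_letters (a b : M i) : (CoprodI.of a * u)⁻¹ * (CoprodI.of b * v) =
      u⁻¹ * CoprodI.of (a⁻¹ * b) * v := by
    rw [map_mul, map_inv]
    group
  rw [hx, hy, twist_of_mul _ _ hu, twist_of_mul _ _ hv, merge_letters, merge_letters]
  by_cases hab : firstLetter i x = firstLetter i y
  · rw [hab, inv_mul_cancel, inv_mul_cancel]
  · rw [indexWord_inv_mul_of_mul _ hu hv, indexWord_inv_mul_of_mul _ hu hv]
    · rwa [Ne, inv_mul_eq_one]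
    · rwa [Ne, inv_mul_eq_one, τ.apply_eq_iff_eq]

theorem twist_mul_of {i : ι} (τ : Equiv.Perm (M i)) {x : CoprodI M}
    (hx : x ∉ Set.range (CoprodI.of : M i →* CoprodI M)) {j : ι} (s : M j) :
    twist i τ (x * CoprodI.of s) = twist i τ x * CoprodI.of s := by
  obtain ⟨t, ht, hxt⟩ := exists_eq_firstLetter_mul i x
  have t_ne_one : t ≠ 1 := by
    rintro rfl
    exact hx ⟨_, (hxt.trans (mul_one _)).symm⟩
  rw [hxt, mul_assoc, twist_of_mul _ _ ht,
    twist_of_mul _ _ (head?_indexWord_mul_of_ne_some t_ne_one ht j s), mul_assoc]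

theorem twistPerm_mem_treeGroup (i : ι) [Finite (M i)] (τ : Equiv.Perm (M i)) :
    twistPerm i τ ∈ treeGroup M :=
  ⟨indexWord_inv_twist_mul_twist i τ, fun _ s =>
    (Set.finite_range (CoprodI.of : M i →* CoprodI M)).subset fun _ hx =>
      by_contra fun hx' => hx (twist_mul_of τ hx' s)⟩

theorem rigidStabilizer_branch_ne_bot {i : ι} [Finite (M i)] {τ : Equiv.Perm (M i)}
    (hτ1 : τ 1 = 1) (hτ : τ ≠ 1) :
    rigidStabilizer (treeGroup M) (branch i (1 : CoprodI M)) ≠ ⊥ := by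
  have twist_mem : ⟨twistPerm i τ, twistPerm_mem_treeGroup i τ⟩ ∈
      rigidStabilizer (treeGroup M) (branch i (1 : CoprodI M)) := by
    refine mem_rigidStabilizer_iff.2 fun x hx => ?_
    rw [mem_branch, inv_one, one_mul] at hx
    rw [treeGroup_smul_def, twistPerm_apply]
    simpa [hτ1] using twist_of_mul τ 1 hx
  refine fun hbot => hτ (Equiv.ext fun a => CoprodI.of_injective i ?_)
  have twistPerm_eq_one := congrArg Subtype.val ((Subgroup.eq_bot_iff_forall _).1 hbot _ twist_mem)
  calc CoprodI.of (τ a) = twist i τ (CoprodI.of a) := by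
        simpa using (twist_of_mul (u := 1) τ a (by simp)).symm
    _ = CoprodI.of a := DFunLike.congr_fun twistPerm_eq_one (CoprodI.of a)

theorem isHalfSpaceSystem_halfSpaces [∀ i, Nontrivial (M i)]
    (hι : ∀ i j : ι, ∃ k, k ≠ i ∧ k ≠ j) {i : ι} [Finite (M i)] {τ : Equiv.Perm (M i)}
    (hτ1 : τ 1 = 1) (hτ : τ ≠ 1) : IsHalfSpaceSystem (treeGroup M) (halfSpaces M) where
  smul_mem g _ := smul_mem_halfSpaces g
  compl_mem _ := compl_mem_halfSpaces
  nested _ hH _ hK := halfSpaces_nested hH hK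
  exists_disjoint_smul _ := exists_disjoint_smul_halfSpace hι
  exists_smul_subset _ hH _ hK := exists_smul_halfSpace_subset hι hH hK
  exists_rigidStabilizer_ne_bot :=
    ⟨_, branch_mem_halfSpaces i 1, rigidStabilizer_branch_ne_bot hτ1 hτ⟩

/-- The permutations that preserve index words (so fix `1`) and commute with right multiplication
by letters at all words of length at least `n`. The stabilizer of `1` in `treeGroup M` is contained
in the union of these subgroups. -/
def stabilizerLevel (M : ι → Type*) [∀ i, Group (M i)] [∀ i, DecidableEq (M i)] (n : ℕ) :
    Subgroup (Equiv.Perm (CoprodI M)) where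
  carrier := {g | (∀ x, indexWord (g x) = indexWord x) ∧ ∀ x, n ≤ (indexWord x).length →
    ∀ i (s : M i), g (x * CoprodI.of s) = g x * CoprodI.of s}
  one_mem' := ⟨fun _ => rfl, fun _ _ _ _ => rfl⟩
  mul_mem' := by
    rintro g h ⟨hg, g_mul_of⟩ ⟨hh, h_mul_of⟩
    refine ⟨fun x => (hg _).trans (hh _), fun x hx i s => ?_⟩
    rw [Equiv.Perm.mul_apply, Equiv.Perm.mul_apply, h_mul_of x hx, g_mul_of _ (by rwa [hh])]
  inv_mem' := by
    rintro g ⟨hg, g_mul_of⟩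
    have indexWord_inv_apply (x : CoprodI M) : indexWord (g⁻¹ x) = indexWord x := by
      rw [← hg, Equiv.Perm.coe_inv, g.apply_symm_apply]
    refine ⟨indexWord_inv_apply, fun x hx i s => ?_⟩
    rw [Equiv.Perm.inv_eq_iff_eq, g_mul_of _ (by rwa [indexWord_inv_apply]), Equiv.Perm.coe_inv,
      g.apply_symm_apply]

theorem monotone_stabilizerLevel : Monotone (stabilizerLevel M) :=
  fun _ _ h _ hg => ⟨hg.1, fun x hx => hg.2 x (h.trans hx)⟩

theorem stabilizerLevel_ext {n : ℕ} {g h : Equiv.Perm (CoprodI M)} (hg : g ∈ stabilizerLevel M n)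
    (hh : h ∈ stabilizerLevel M n)
    (eq_on_ball : ∀ x, (indexWord x).length ≤ n → g x = h x) : g = h := by
  have eq_on_larger_ball (m : ℕ) : ∀ x, (indexWord x).length ≤ n + m → g x = h x := by
    induction m with
    | zero => exact eq_on_ball
    | succ m ih =>
      intro x hx
      by_cases hxn : (indexWord x).length ≤ n
      · exact eq_on_ball x hxn
      have x_ne_one : x ≠ 1 := by
        rintro rfl
        simp at hxn
      obtain ⟨y, i, s, rfl, hs, hy⟩ := exists_eq_mul_of x_ne_one
      rw [indexWord_mul_of hs hy, List.length_append, List.length_singleton] at hx hxn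
      have n_le : n ≤ (indexWord y).length := by omega
      rw [hg.2 y n_le, hh.2 y n_le, ih y (by omega)]
  exact Equiv.ext fun x => eq_on_larger_ball _ x (Nat.le_add_left _ _)

instance finite_stabilizerLevel [Finite ι] [∀ i, Finite (M i)] (n : ℕ) :
    Finite (stabilizerLevel M n) := by
  let ball := {x : CoprodI M | (indexWord x).length ≤ n}
  have finite_ball : Finite ball := finite_setOf_length_indexWord_le n
  have apply_mem_ball (g : stabilizerLevel M n) (x : ball) :
      (g : Equiv.Perm (CoprodI M)) x ∈ ball := by
    rw [Set.mem_ofPred_eq, g.2.1]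
    exact x.2
  refine Finite.of_injective (fun g (x : ball) => (⟨_, apply_mem_ball g x⟩ : ball))
    fun g h hgh => Subtype.ext (stabilizerLevel_ext g.2 h.2 fun x hx => ?_)
  exact congrArg Subtype.val (congrFun hgh ⟨x, hx⟩)

theorem exists_mem_stabilizerLevel [Finite ι] [∀ i, Finite (M i)] {g : treeGroup M}
    (hg : g • (1 : CoprodI M) = 1) : ∃ n, (g : Equiv.Perm (CoprodI M)) ∈ stabilizerLevel M n := by
  let f : Equiv.Perm (CoprodI M) := g
  have finite_exceptions :
      (⋃ p : Σ i, M i, {x | f (x * CoprodI.of p.2) ≠ f x * CoprodI.of p.2}).Finite :=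
    Set.finite_iUnion fun p => g.2.2 p.1 p.2
  obtain ⟨n, hn⟩ := (finite_exceptions.image fun x => (indexWord x).length).bddAbove
  refine ⟨n + 1, fun x => ?_, fun x hx i s => ?_⟩
  · have indexWord_apply := indexWord_inv_smul_mul_smul g 1 x
    rwa [hg, inv_one, one_mul, one_mul] at indexWord_apply
  · by_contra h
    exact absurd (hn ⟨x, Set.mem_iUnion.2 ⟨⟨i, s⟩, h⟩, rfl⟩) (Nat.not_le.2 hx)

end TreeGroup

section Examples

open Monoid

theorem isJustInfinite_of_isSimpleGroup {Γ : Type*} [Group Γ] [Infinite Γ] [IsSimpleGroup Γ] :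
    IsJustInfinite Γ := by
  refine ⟨inferInstance, fun N hN hN' => ?_⟩
  rw [(IsSimpleGroup.eq_bot_or_eq_top_of_normal N hN).resolve_left hN']
  infer_instance

/-- The factors of the free product `(ℤ/3) * (ℤ/3) * (ℤ/3)`, whose tree group has the simple
group of the example as its monolith. -/
abbrev Letters (_ : Fin 3) : Type := Multiplicative (ZMod 3)

theorem isHalfSpaceSystem_letters : IsHalfSpaceSystem (treeGroup Letters) (halfSpaces Letters) := by
  refine isHalfSpaceSystem_halfSpaces (by decide) (i := 0)
    (τ := (Equiv.inv (Multiplicative (ZMod 3)) : Equiv.Perm (Letters 0))) inv_one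
    fun inv_eq_one => ?_
  have inv_generator : (Multiplicative.ofAdd (1 : ZMod 3))⁻¹ = Multiplicative.ofAdd 1 :=
    DFunLike.congr_fun inv_eq_one (Multiplicative.ofAdd (1 : ZMod 3))
  exact absurd inv_generator (by decide)

theorem not_isAmenable_monolith_treeGroup : ¬ IsAmenable (monolith (treeGroup Letters)) :=
  isHalfSpaceSystem_letters.compresses_monolith.not_isAmenable
    isHalfSpaceSystem_letters.compl_mem (branch_mem_halfSpaces 0 1)
    (branch_mem_halfSpaces 1 1) (branch_mem_halfSpaces 2 1) (disjoint_branch (by decide) 1)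
    (disjoint_branch (by decide) 1) (disjoint_branch (by decide) 1)

theorem not_isCStarSimple_monolith_treeGroup :
    ¬ IsCStarSimple (monolith (treeGroup Letters)) := by
  let φ := (treeGroup Letters).subtype.comp (monolith (treeGroup Letters)).subtype
  have φ_injective : Function.Injective φ := Subtype.val_injective.comp Subtype.val_injective
  have finite_level (n : ℕ) : Finite ((stabilizerLevel Letters n).comap φ) :=
    Finite.of_injective (fun g => (⟨φ g, g.2⟩ : stabilizerLevel Letters n))
      fun _ _ h => Subtype.ext (φ_injective (Subtype.mk.inj h))
  have branch_mem := branch_mem_halfSpaces (M := Letters) 0 1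
  obtain ⟨a, a_ne_one, a_fixes⟩ := isHalfSpaceSystem_letters.exists_monolith_ne_one branch_mem
  obtain ⟨b, b_ne_one, b_fixes⟩ :=
    isHalfSpaceSystem_letters.exists_monolith_ne_one (compl_mem_halfSpaces branch_mem)
  refine not_isCStarSimple_of_locallyFinite_stabilizer (X := CoprodI Letters) (x₀ := 1)
    (L := fun n => (stabilizerLevel Letters n).comap φ)
    (fun _ _ h => Subgroup.comap_mono (monotone_stabilizerLevel h))
    (fun g hg => exists_mem_stabilizerLevel (g := g.1) hg) a_ne_one b_ne_one fun x => ?_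
  by_cases hx : x ∈ branch 0 1
  · exact Or.inr (b_fixes x (Set.notMem_compl_iff.2 hx))
  · exact Or.inl (a_fixes x hx)

theorem exists_isSimpleGroup_not_isNCJustInfinite :
    ∃ (Γ : Type) (_ : Group Γ), IsSimpleGroup Γ ∧ ¬ IsAmenable Γ ∧ IsJustInfinite Γ ∧
      ¬ IsNCJustInfinite Γ := by
  have isSimpleGroup := isHalfSpaceSystem_letters.isSimpleGroup_monolith
  have infinite : Infinite (monolith (treeGroup Letters)) :=
    not_finite_iff_infinite.1 fun _ => not_isAmenable_monolith_treeGroup isAmenable_of_finite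
  exact ⟨monolith (treeGroup Letters), inferInstance, isSimpleGroup,
    not_isAmenable_monolith_treeGroup, isJustInfinite_of_isSimpleGroup,
    fun h => h.isAmenable_or_isCStarSimple.elim
      not_isAmenable_monolith_treeGroup not_isCStarSimple_monolith_treeGroup⟩

theorem isJustInfinite_multiplicative_int : IsJustInfinite (Multiplicative ℤ) := by
  refine ⟨inferInstance, fun N _ hN => ?_⟩
  obtain ⟨g, g_mem, g_ne_one⟩ := N.bot_or_exists_ne_one.resolve_left hN
  have zmultiples_le : (AddSubgroup.zmultiples g.toAdd).toSubgroup ≤ N := by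
    rintro _ ⟨k, rfl⟩
    exact N.zpow_mem g_mem k
  have finiteIndex_zmultiples : (AddSubgroup.zmultiples g.toAdd).toSubgroup.FiniteIndex := by
    refine ⟨?_⟩
    rw [AddSubgroup.index_toSubgroup, Int.index_zmultiples, Int.natAbs_ne_zero]
    exact g_ne_one
  exact Subgroup.finiteIndex_of_le zmultiples_le

theorem not_isICC_of_comm {Γ : Type*} [CommGroup Γ] [Nontrivial Γ] : ¬ IsICC Γ := by
  intro h
  obtain ⟨g, hg⟩ := exists_ne (1 : Γ)
  refine h g hg ((Set.finite_singleton g).subset fun x hx => ?_)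
  exact (isConj_iff_eq.1 hx).symm

end Examples

end NCJI

end

theorem proposition2 :
    (∀ (Γ : Type*) [Group Γ], NCJI.IsNCJustInfinite Γ →
      (NCJI.IsAmenable Γ ∨ NCJI.IsCStarSimple Γ) ∧ NCJI.IsICC Γ) ∧
    (∃ (Γ : Type) (_ : Group Γ), IsSimpleGroup Γ ∧ ¬ NCJI.IsAmenable Γ ∧
      NCJI.IsJustInfinite Γ ∧ ¬ NCJI.IsNCJustInfinite Γ) ∧
    (NCJI.IsJustInfinite (Multiplicative ℤ) ∧ ¬ NCJI.IsNCJustInfinite (Multiplicative ℤ)) :=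
  ⟨fun _ _ h => ⟨h.isAmenable_or_isCStarSimple, h.isICC⟩,
    NCJI.exists_isSimpleGroup_not_isNCJustInfinite, NCJI.isJustInfinite_multiplicative_int,
    fun h => NCJI.not_isICC_of_comm h.isICC⟩
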